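/- Let $\tau$ be the substitution $1\mapsto 101$, $0\mapsto 1$, let $\mathbf s=(s_j)_{j\ge 0}=\lim_{j\to\infty}\tau^j(1)$ be its fixed point starting with $1$, and let $H_{m,n}=\det(s_{m+i+j})_{0\le i,j\le n-1}$ be its Hankel determinants. Let $f_{2j}=|\tau^j(1)|$ and $f_{2j+1}=|\tau^j(10)|$ for $j\ge 0$, where $|w|$ is the length of $w$. Every integer $n\ge 0$ has a unique representation $n=\sum_{i\ge 0}a_i(n)f_i$ with finitely many nonzero digits $a_i(n)\in\{0,1\}$ such that $a_i(n)a_{i+1}(n)=0$ for all $i$ and $a_i(n)a_{i+2}(n)=0$ for all even $i$; put $\Phi_k(n)=\sum_{i=0}^{2k+2}a_i(n)f_i$. For $k\ge 0$ let $$F''_k=\Big\{y\in\mathbb N:\ \Phi_k(y)=\tfrac{f_{2k+1}}2,\ \Phi_{k+1}(y)\ne\tfrac{f_{2k+1}}2\Big\},$$ let $\beta'_1<\beta'_2<\cdots$ be the elements of $F''_k$ in ascending order, $\beta_i=\beta'_i+f_{2k}$, and let $$V_k=\bigcup_{i\ge 1}\big\{(m,n)\in\mathbb N^2:\ f_{2k}\le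 n<f_{2k+2},\ \beta_i<m+n\le\beta_i+f_{2k+1}\big\}.$$ Theorem. Let $k\ge 0$. For all $(m,n)\in V_k$: 1. when $n=f_{2k+2}-1$, $\displaystyle H_{m,n}=(-1)^{\frac{f_{2k+2}+f_{2k+1}-3}{2}}\cdot\frac{f_{2k+1}}{2}$; 2. when $n=f_{2k}$, $\displaystyle H_{m,n}=(-1)^{k+1}(-1)^{\frac{f_{2k+2}-1}{2}}\cdot\frac{f_{2k+1}}{2}$; 3. when $f_{2k}<n<f_{2k+2}-1$: if $m+n=\beta_i+1$ or $m+n=\beta_i+f_{2k+1}$ for some $i\ge 1$, then $$H_{m,n}=(-1)^{\frac{f_{2k+2}+f_{2k+1}-3}{2}}\,(-1)^{(f_{2k+2}-1-n)(k+1)}\,(-1)^{\frac{(f_{2k+2}-1-n)(f_{2k+2}-2-n)}{2}}\cdot\frac{f_{2k+1}}{2};$$ otherwise $H_{m,n}=0$. -/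

import Mathlib

namespace TauHankel

/-- The substitution on letters: `1 ↦ 101`, `0 ↦ 1`, where `true` is the letter `1` and `false`
the letter `0`. -/
def tauLetter : Bool → List Bool
  | true => [true, false, true]
  | false => [true]

/-- The substitution `τ` on finite words. -/
def tau (w : List Bool) : List Bool := w.flatMap tauLetter

/-- `f (2j) = |τ^j(1)|` and `f (2j+1) = |τ^j(10)|`. -/
def f (n : ℕ) : ℕ :=
  if Even n then (tau^[n / 2] [true]).length else (tau^[n / 2] [true, false]).length

/-- The letter in position `n` (counted from `0`) of the fixed point `lim_j τ^j(1)` of `τ`, as an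
integer. The word `τ^n(1)` is long enough to show this letter; see `s_eq`. -/
def s (n : ℕ) : ℤ := if (tau^[n] [true]).getD n false then 1 else 0

/-- The Hankel determinant `H_{m,n} = det (s_{m+i+j})_{0 ≤ i,j ≤ n-1}`. -/
def H (m n : ℕ) : ℤ :=
  (Matrix.of fun i j : Fin n => s (m + (i : ℕ) + (j : ℕ))).det

/-- `a` is the digit sequence of an `f`-representation of `n`: `n = ∑ a_i f_i` with finitely many
nonzero digits `a_i ∈ {0,1}`, no two consecutive digits `1`, and not `a_i = a_{i+2} = 1` for
even `i`. -/
structure IsFRep (n : ℕ) (a : ℕ →₀ ℕ) : Prop where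
  digit : ∀ i, a i = 0 ∨ a i = 1
  adj : ∀ i, a i * a (i + 1) = 0
  even_gap : ∀ i, Even i → a i * a (i + 2) = 0
  sum_eq : n = a.sum fun i d => d * f i

theorem tau_append (u v : List Bool) : tau (u ++ v) = tau u ++ tau v := by
  simp [tau]

theorem tau_iter_append (j : ℕ) (u v : List Bool) :
    tau^[j] (u ++ v) = tau^[j] u ++ tau^[j] v := by
  induction j generalizing u v with
  | zero => rfl
  | succ j ih => simp only [Function.iterate_succ, Function.comp, tau_append, ih]

theorem tau_iter_true (j : ℕ) :
    tau^[j + 1] [true] = tau^[j] [true] ++ tau^[j] [false, true] := by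
  rw [← tau_iter_append]; rfl

theorem f_even (j : ℕ) : f (2 * j) = (tau^[j] [true]).length := by
  simp [f]

theorem f_odd (j : ℕ) : f (2 * j + 1) = (tau^[j] [true, false]).length := by
  have h : (2 * j + 1) / 2 = j := by omega
  have h2 : ¬ Even (2 * j + 1) := by simp
  rw [f, if_neg h2, h]

theorem f_zero : f 0 = 1 := rfl

theorem f_one : f 1 = 2 := rfl

theorem f_even_succ (j : ℕ) : f (2 * j + 2) = f (2 * j) + f (2 * j + 1) := by
  have h : tau^[j + 1] [true] = tau^[j] [true, false] ++ tau^[j] [true] := by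
    rw [← tau_iter_append]; rfl
  rw [show 2 * j + 2 = 2 * (j + 1) by ring, f_even, f_even, f_odd, h, List.length_append, add_comm]

theorem f_odd_succ (j : ℕ) : f (2 * j + 3) = f (2 * j) + f (2 * j + 2) := by
  have h : tau^[j + 1] [true, false]
      = tau^[j] [true, false] ++ (tau^[j] [true] ++ tau^[j] [true]) := by
    rw [← tau_iter_append, ← tau_iter_append]; rfl
  rw [f_even_succ, show 2 * j + 3 = 2 * (j + 1) + 1 by ring, f_odd, f_even, f_odd, h,
    List.length_append, List.length_append]
  ring

theorem f_pos (n : ℕ) : 0 < f n := by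
  induction n using Nat.strong_induction_on with
  | _ n ih =>
    match n with
    | 0 => simp [f_zero]
    | 1 => simp [f_one]
    | n + 2 =>
      rcases Nat.even_or_odd' n with ⟨j, rfl | rfl⟩
      · rw [f_even_succ]; exact Nat.add_pos_left (ih _ (by omega)) _
      · rw [show 2 * j + 1 + 2 = 2 * j + 3 by ring, f_odd_succ]
        exact Nat.add_pos_left (ih _ (by omega)) _

theorem f_lt_succ (n : ℕ) : f n < f (n + 1) := by
  rcases Nat.even_or_odd' n with ⟨j, rfl | rfl⟩
  · cases j with
    | zero => simp [f_zero, f_one]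
    | succ j =>
      have h := f_odd_succ j
      have h2 := f_pos (2 * j)
      change f (2 * j + 2) < f (2 * j + 3)
      omega
  · have h := f_even_succ j
    have h2 := f_pos (2 * j)
    change f (2 * j + 1) < f (2 * j + 2)
    omega

theorem f_strictMono : StrictMono f := strictMono_nat_of_lt_succ f_lt_succ

/-- `f_{2j}` is odd and `f_{2j+1}` is even, so that all halves below are exact. -/
theorem f_parity (j : ℕ) : Odd (f (2 * j)) ∧ Even (f (2 * j + 1)) := by
  induction j with
  | zero => simp [f_zero, f_one]
  | succ j ih =>
    have h1 := f_even_succ j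
    have h2 := f_odd_succ j
    rw [show 2 * (j + 1) + 1 = 2 * j + 3 by ring, show 2 * (j + 1) = 2 * j + 2 by ring]
    obtain ⟨⟨x, hx⟩, ⟨y, hy⟩⟩ := ih
    exact ⟨⟨x + y, by omega⟩, ⟨2 * x + 1 + y, by omega⟩⟩

/-- `s n` is the letter in position `n` of every word `τ^j(1)` that is long enough. -/
theorem s_eq (j n : ℕ) (h : n < (tau^[j] [true]).length) :
    s n = if (tau^[j] [true])[n] then 1 else 0 := by
  have hlen : ∀ j, j < (tau^[j] [true]).length := fun j => by
    rw [← f_even]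
    have := f_strictMono.le_apply (x := 2 * j)
    rcases Nat.eq_zero_or_pos j with rfl | hj
    · simp [f_zero]
    · omega
  have key : ∀ d i n, n < (tau^[i] [true]).length →
      (tau^[i + d] [true]).getD n false = (tau^[i] [true]).getD n false := by
    intro d
    induction d with
    | zero => intros; rfl
    | succ d ih =>
      intro i n hn
      rw [← ih i n hn, ← add_assoc, tau_iter_true]
      refine List.getD_append _ _ _ _ (lt_of_lt_of_le hn ?_)
      rw [← f_even, ← f_even]
      exact f_strictMono.monotone (by omega)
  have h2 : (tau^[n] [true]).getD n false = (tau^[j] [true]).getD n false := by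
    rcases le_total n j with hnj | hnj
    · obtain ⟨d, rfl⟩ := Nat.exists_eq_add_of_le hnj
      exact (key d n n (hlen n)).symm
    · obtain ⟨d, rfl⟩ := Nat.exists_eq_add_of_le hnj
      exact key d j _ h
  rw [s, h2, List.getD_eq_getElem _ _ h]

theorem partial_lt (a : ℕ → ℕ) (h1 : ∀ i, a i = 0 ∨ a i = 1) (h2 : ∀ i, a i * a (i + 1) = 0)
    (h3 : ∀ i, Even i → a i * a (i + 2) = 0) (t : ℕ) :
    ∑ i ∈ Finset.range t, a i * f i < f t := by
  induction t using Nat.strong_induction_on with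
  | _ t ih =>
    match t with
    | 0 => simp [f_zero]
    | 1 => rcases h1 0 with h | h <;> simp [h, f_zero, f_one]
    | 2 =>
      have h := h2 0
      have hf : f 2 = 3 := rfl
      rcases h1 0 with h0 | h0 <;> rcases h1 1 with h1' | h1' <;>
        simp_all [Finset.sum_range_succ, f_zero, f_one]
    | t + 3 =>
      rcases h1 (t + 2) with h | h
      · rw [Finset.sum_range_succ, h, zero_mul, add_zero]
        exact (ih (t + 2) (by omega)).trans (f_lt_succ _)
      · have hz : a (t + 1) = 0 := by simpa [h] using h2 (t + 1)
        rcases Nat.even_or_odd' t with ⟨j, rfl | rfl⟩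
        · have hz2 : a (2 * j) = 0 := by simpa [h] using h3 (2 * j) (by simp)
          have hi := ih (2 * j) (by omega)
          rw [Finset.sum_range_succ, Finset.sum_range_succ, Finset.sum_range_succ, h, hz, hz2,
            f_odd_succ]
          omega
        · have hi := ih (2 * j + 2) (by omega)
          have hf : f (2 * j + 1 + 3) = f (2 * j + 2) + f (2 * j + 1 + 2) := f_even_succ (j + 1)
          rw [Finset.sum_range_succ, Finset.sum_range_succ, h, hz, hf, zero_mul, one_mul, add_zero]
          exact Nat.add_lt_add_right hi _

theorem sum_eq_range (a : ℕ →₀ ℕ) (t : ℕ) (h : ∀ i, t ≤ i → a i = 0) :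
    (a.sum fun i d => d * f i) = ∑ i ∈ Finset.range t, a i * f i := by
  refine Finsupp.sum_of_support_subset _ ?_ _ (by simp)
  intro i hi
  by_contra hc
  exact (Finsupp.mem_support_iff.mp hi) (h i (by simpa using hc))

/-- Adding the digit `t` to an `f`-representation with digits below `u`. -/
theorem IsFRep.add_digit {u t : ℕ} (hu : u ≤ t) (g1 : ∀ i, i < u → i + 1 ≠ t)
    (g2 : ∀ i, i < u → Even i → i + 2 ≠ t) {m : ℕ} {a : ℕ →₀ ℕ} (ha : IsFRep m a)
    (hz : ∀ i, u ≤ i → a i = 0) :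
    ∃ b, IsFRep (m + f t) b ∧ ∀ i, b i = if i = t then 1 else a i := by
  have val : ∀ i, (a + Finsupp.single t 1 : ℕ →₀ ℕ) i = if i = t then 1 else a i := by
    intro i
    by_cases hi : i = t
    · subst hi; simp [hz i hu]
    · simp [hi]
  refine ⟨a + Finsupp.single t 1, ⟨?_, ?_, ?_, ?_⟩, val⟩
  · intro i; rw [val]; split_ifs
    · exact Or.inr rfl
    · exact ha.digit i
  · intro i
    rw [val, val]
    by_cases h1 : i = t
    · rw [if_neg (show i + 1 ≠ t by omega), hz (i + 1) (by omega), mul_zero]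
    · rw [if_neg h1]
      by_cases h2 : i + 1 = t
      · rw [hz i (by by_contra hc; exact g1 i (by omega) h2), zero_mul]
      · rw [if_neg h2]; exact ha.adj i
  · intro i he
    rw [val, val]
    by_cases h1 : i = t
    · rw [if_neg (show i + 2 ≠ t by omega), hz (i + 2) (by omega), mul_zero]
    · rw [if_neg h1]
      by_cases h2 : i + 2 = t
      · rw [hz i (by by_contra hc; exact g2 i (by omega) he h2), zero_mul]
      · rw [if_neg h2]; exact ha.even_gap i he
  · rw [Finsupp.sum_add_index' (by simp) (by intros; ring), ← ha.sum_eq]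
    simp

theorem exists_fRep_aux (t : ℕ) : ∀ n, n < f t → ∃ a, IsFRep n a ∧ ∀ i, t ≤ i → a i = 0 := by
  induction t using Nat.strong_induction_on with
  | _ t ih =>
    intro n hn
    match t with
    | 0 =>
      have : n = 0 := by rw [f_zero] at hn; omega
      subst this
      exact ⟨0, ⟨by simp, by simp, by simp, by simp⟩, by simp⟩
    | t + 1 =>
      by_cases hlt : n < f t
      · obtain ⟨a, ha, hz⟩ := ih t (by omega) n hlt
        exact ⟨a, ha, fun i hi => hz i (by omega)⟩
      · obtain ⟨u, hut, hr, g1, g2⟩ : ∃ u, u ≤ t ∧ n - f t < f u ∧ (∀ i, i < u → i + 1 ≠ t) ∧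
            (∀ i, i < u → Even i → i + 2 ≠ t) := by
          rcases Nat.even_or_odd' t with ⟨j, rfl | rfl⟩
          · cases j with
            | zero => exact ⟨0, le_rfl, by simp [f_zero, f_one] at hn ⊢; omega, by simp, by simp⟩
            | succ j =>
              have h := f_odd_succ j
              change n < f (2 * j + 3) at hn
              change ¬ n < f (2 * j + 2) at hlt
              exact ⟨2 * j, by omega, by change n - f (2 * j + 2) < _; omega, by intros; omega, by intros; omega⟩
          · have h := f_even_succ j
            exact ⟨2 * j, by omega, by rw [show 2 * j + 1 + 1 = 2 * j + 2 by ring] at hn; omega,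
              by intros; omega, fun i _ he => by rcases he with ⟨x, hx⟩; omega⟩
        obtain ⟨a, ha, hz⟩ := ih u (by omega) _ hr
        obtain ⟨b, hb, val⟩ := ha.add_digit hut g1 g2 hz
        rw [show n - f t + f t = n by omega] at hb
        exact ⟨b, hb, fun i hi => by rw [val, if_neg (by omega), hz i (by omega)]⟩

/-- Every natural number has exactly one `f`-representation. -/
theorem existsUnique_fRep (n : ℕ) : ∃! a, IsFRep n a := by
  obtain ⟨a, ha, -⟩ := exists_fRep_aux n n <| by
    rcases Nat.eq_zero_or_pos n with rfl | hn
    · simp [f_zero]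
    · obtain ⟨m, rfl⟩ := Nat.exists_eq_add_of_lt hn
      have := f_strictMono.le_apply (x := m)
      have h0 : ∀ m, m + 1 ≤ f m := fun m => by
        induction m with
        | zero => simp [f_zero]
        | succ m ihm => have := f_lt_succ m; omega
      have := h0 (0 + m + 1); omega
  refine ⟨a, ha, fun b hb => ?_⟩
  have uniq : ∀ t, ∑ i ∈ Finset.range t, b i * f i = ∑ i ∈ Finset.range t, a i * f i →
      ∀ i, i < t → b i = a i := by
    intro t
    induction t with
    | zero => intro _ i hi; omega
    | succ t iht =>
      intro h
      have la := partial_lt a ha.digit ha.adj ha.even_gap t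
      have lb := partial_lt b hb.digit hb.adj hb.even_gap t
      rw [Finset.sum_range_succ, Finset.sum_range_succ] at h
      have ht : b t = a t := by
        rcases ha.digit t with h1 | h1 <;> rcases hb.digit t with h2 | h2 <;>
          rw [h1, h2] at h ⊢ <;> omega
      rw [ht] at h
      intro i hi
      rcases Nat.lt_succ_iff_lt_or_eq.mp hi with hi | rfl
      · exact iht (by omega) i hi
      · exact ht
  obtain ⟨t, hta, htb⟩ : ∃ t, (∀ i, t ≤ i → a i = 0) ∧ ∀ i, t ≤ i → b i = 0 := by
    refine ⟨(a.support ∪ b.support).sup id + 1, fun i hi => ?_, fun i hi => ?_⟩ <;>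
    · by_contra hc
      have := Finset.le_sup (f := id) (s := a.support ∪ b.support) (b := i) (by simp [hc])
      simp only [id] at this
      omega
  have hs := uniq t (by rw [← sum_eq_range a t hta, ← sum_eq_range b t htb, ← ha.sum_eq,
    ← hb.sum_eq])
  ext i
  by_cases hi : i < t
  · exact hs i hi
  · rw [hta i (by omega), htb i (by omega)]

/-- The digits `a_i(n)` of the `f`-representation of `n`. -/
noncomputable def fDigits (n : ℕ) : ℕ →₀ ℕ := (existsUnique_fRep n).choose

theorem isFRep_fDigits (n : ℕ) : IsFRep n (fDigits n) := (existsUnique_fRep n).choose_spec.1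

/-- The truncated `f`-representation `Φ_k(n) = ∑_{i=0}^{2k+2} a_i(n) f_i`. -/
noncomputable def Phi (k n : ℕ) : ℕ := ∑ i ∈ Finset.range (2 * k + 3), fDigits n i * f i

/-- `F_k = {y : Φ_k(y) = f_{2k+1}/2}`. -/
def F (k : ℕ) : Set ℕ := {y | Phi k y = f (2 * k + 1) / 2}

/-- `F'_k = {y : Φ_{k+1}(y) = f_{2k+1}/2}`. -/
def F' (k : ℕ) : Set ℕ := {y | Phi (k + 1) y = f (2 * k + 1) / 2}

/-- `F''_k = F_k \ F'_k`. -/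
def F'' (k : ℕ) : Set ℕ := F k \ F' k

/-- `F''_k` is infinite: it contains `f_{2k+1}/2 + f_{2k+3} + f_j` for all `j ≥ 2k+6`. -/
theorem infinite_F'' (k : ℕ) : (F'' k).Infinite := by
  have hmem : ∀ j, f (2 * k + 1) / 2 + f (2 * k + 3) + f (2 * k + 6 + j) ∈ F'' k := by
    intro j
    have hp := f_pos (2 * k + 1)
    obtain ⟨a, ha, hz⟩ := exists_fRep_aux (2 * k + 1) (f (2 * k + 1) / 2) (by omega)
    obtain ⟨b, hb, vb⟩ := ha.add_digit (t := 2 * k + 3) (by omega) (by intros; omega)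
      (fun i _ he h => by rcases he with ⟨x, hx⟩; omega) hz
    have hzb : ∀ i, 2 * k + 4 ≤ i → b i = 0 := fun i hi => by
      rw [vb, if_neg (by omega), hz i (by omega)]
    obtain ⟨c, hc, vc⟩ := hb.add_digit (t := 2 * k + 6 + j) (by omega) (by intros; omega)
      (fun i _ he h => by omega) hzb
    have hd := (existsUnique_fRep _).unique (isFRep_fDigits _) hc
    have ca : ∀ i, i ≠ 2 * k + 3 → i < 2 * k + 5 → c i = a i := fun i h1 h2 => by
      rw [vc, if_neg (by omega), vb, if_neg h1]
    have hs : ∑ i ∈ Finset.range (2 * k + 3), c i * f i = f (2 * k + 1) / 2 := by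
      rw [Finset.sum_congr rfl (g := fun i => a i * f i), ← sum_eq_range a _
        (fun i hi => hz i (by omega)), ← ha.sum_eq]
      intro i hi
      have := Finset.mem_range.mp hi
      rw [ca i (by omega) (by omega)]
    refine ⟨by rw [F, Set.mem_ofPred_eq, Phi, hd, hs], ?_⟩
    rw [F', Set.mem_ofPred_eq, Phi, hd, show 2 * (k + 1) + 3 = 2 * k + 3 + 1 + 1 by ring,
      Finset.sum_range_succ, Finset.sum_range_succ, hs, vc (2 * k + 3), if_neg (by omega), vb,
      if_pos rfl]
    have := f_pos (2 * k + 3)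
    omega
  refine Set.infinite_of_injective_forall_mem (fun x y h => ?_) hmem
  have := f_strictMono.injective (Nat.add_left_cancel h)
  omega

/-- `β'_i`, the `i`-th element, counted from `i = 1`, of the infinite set `F''_k` in ascending
order. -/
noncomputable def beta' (k i : ℕ) : ℕ := Nat.nth (fun y => y ∈ F'' k) (i - 1)

/-- `β_i = β'_i + f_{2k}`. -/
noncomputable def beta (k i : ℕ) : ℕ := beta' k i + f (2 * k)

/-- The parallelogram `V_{k,i}`, a set of pairs `(m, n)`. -/
def VPar (k i : ℕ) : Set (ℕ × ℕ) :=
  {p | f (2 * k) ≤ p.2 ∧ p.2 < f (2 * k + 2) ∧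
    beta k i < p.2 + p.1 ∧ p.2 + p.1 ≤ beta k i + f (2 * k + 1)}

/-- `V_k = ⋃_{i ≥ 1} V_{k,i}`. -/
def V (k : ℕ) : Set (ℕ × ℕ) := ⋃ i ≥ 1, VPar k i

end TauHankel

/-!
The parallelograms of `V_k` are windows of zeros, with their frames, in the table of Hankel
determinants, and such windows come from stretches of the sequence that satisfy a short linear
recurrence. Here the recurrence is a period. Put `r = f_{2k}` and `P = f_{2k+1}`. To the right of
each `y` in `F''_k` the fixed point has period `r` on the positions strictly between `y` and
`z = y + 2r + P - 1`, but not beyond (`exists_isPeriodRun`). For `k = 0` this is the factor `0110`.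
Applying `τ` turns such a run for `k` into one for `k + 1` (`IsPeriodRun.succ`), and shifting the
digits of `n` by two places corresponds to passing from a position to the position of its image
under `τ` (`sum_digits_shift`), so that every element of `F''_k` arises in this way from one of
`F''_0`.

In the matrix of `H_{m,n}` subtract from each column the one `r` places before. Inside the run the
differences vanish. Away from the sides of the parallelogram this leaves a zero column
(`det_hankel_eq_zero`). On the sides, the new columns are triangular with respect to the two ends
of the run, and expansion along them leaves a sign, which depends on the defects of periodicity at
`y` and `z`, times a Hankel determinant of order `r` inside the run (`det_hankel_of_period`).

This last matrix is, up to reversal of its columns, the circulant matrix `W` of the word `τ^k(1)`.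
Rotating this word by `q = f_{2k-2}` places exchanges two adjacent letters, because `τ^(k-1)(10)`
and `τ^(k-1)(01)` differ in this way. So `W * (1 - x ^ q) = x ^ a * (1 - x ^ u)` with `u = 1` or
`u = -1` in the algebra of circulants, where `x` is the cyclic shift. Adding the all-ones matrix
makes these factors invertible, `1 - x ^ q` and `1 - x ^ u` are conjugate by permutations, and the
comparison of determinants gives `det W = P / 2`, the number of letters `1` in `τ^k(1)`
(`det_circulant_of_swap`, `det_circulant_tau`).
-/

namespace TauHankel

/-! ### The fixed point as a word -/

/-- The letter in position `n` of the fixed point, as a Boolean; `s n` is its indicator. -/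
def letter (n : ℕ) : Bool := (tau^[n] [true]).getD n false

theorem s_eq_letter (n : ℕ) : s n = if letter n then 1 else 0 := rfl

/-- The factor of length `l` of the fixed point that starts in position `x`. -/
def seg (x l : ℕ) : List Bool := (List.range l).map fun i => letter (x + i)

/-- The position in which the image under `τ` of the letter in position `n` starts. -/
def tauPos (n : ℕ) : ℕ := (tau (seg 0 n)).length

@[simp] theorem length_seg (x l : ℕ) : (seg x l).length = l := by simp [seg]

@[simp] theorem getElem_seg (x l i : ℕ) (h : i < (seg x l).length) :
    (seg x l)[i] = letter (x + i) := by simp [seg]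

theorem seg_add (x l l' : ℕ) : seg x (l + l') = seg x l ++ seg (x + l) l' := by
  simp [seg, List.range_add, Function.comp_def, add_assoc]

@[simp] theorem seg_zero (x : ℕ) : seg x 0 = [] := rfl

@[simp] theorem seg_one (x : ℕ) : seg x 1 = [letter x] := rfl

theorem letter_eq (j n : ℕ) (h : n < (tau^[j] [true]).length) :
    letter n = (tau^[j] [true])[n] := by
  have := s_eq j n h
  rw [s_eq_letter] at this
  cases h1 : letter n <;> cases h2 : (tau^[j] [true])[n] <;> simp_all

theorem seg_zero_f (j : ℕ) : seg 0 (f (2 * j)) = tau^[j] [true] := by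
  refine List.ext_getElem (by simp [f_even]) fun i h1 h2 => ?_
  rw [getElem_seg, zero_add, letter_eq j i h2]

theorem lt_f (n : ℕ) : n < f n := by
  have := f_strictMono.le_apply (x := n)
  induction n with
  | zero => simp [f_zero]
  | succ n ih =>
    have := ih f_strictMono.le_apply
    have := f_lt_succ n
    omega

theorem tau_seg_zero (n : ℕ) : tau (seg 0 n) = seg 0 (tauPos n) := by
  obtain ⟨d, hd⟩ : ∃ d, f (2 * n) = n + d :=
    Nat.exists_eq_add_of_le ((show n ≤ 2 * n by omega).trans (lt_f _).le)
  have h1 : tau (seg 0 n) ++ tau (seg (0 + n) d) = seg 0 (f (2 * (n + 1))) := by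
    rw [← tau_append, ← seg_add, ← hd, seg_zero_f, seg_zero_f, Function.iterate_succ_apply']
  have h2 : tauPos n ≤ f (2 * (n + 1)) := by
    have := congrArg List.length h1
    simp only [List.length_append, length_seg] at this
    unfold tauPos
    omega
  obtain ⟨d', hd'⟩ := Nat.exists_eq_add_of_le h2
  rw [hd', seg_add] at h1
  exact (List.append_inj h1 (by simp [tauPos])).1

/-- The fixed point property: `τ` maps the factor at `x` to the factor at `tauPos x`. -/
theorem tau_seg (x l : ℕ) :
    tauPos (x + l) = tauPos x + (tau (seg x l)).length ∧
      tau (seg x l) = seg (tauPos x) (tau (seg x l)).length := by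
  have h := tau_seg_zero (x + l)
  have h0 : tauPos (x + l) = tauPos x + (tau (seg x l)).length := by
    rw [tauPos, tauPos, seg_add, tau_append, List.length_append, zero_add]
  refine ⟨h0, ?_⟩
  rw [h0, seg_add, tau_append, seg_add, zero_add, zero_add] at h
  exact (List.append_inj h (by simp [tauPos])).2

theorem tau_iter_seg (d x l : ℕ) :
    tauPos^[d] (x + l) = tauPos^[d] x + (tau^[d] (seg x l)).length ∧
      tau^[d] (seg x l) = seg (tauPos^[d] x) (tau^[d] (seg x l)).length := by
  induction d with
  | zero => simp
  | succ d ih =>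
    obtain ⟨h1, h2⟩ := ih
    rw [Function.iterate_succ_apply', Function.iterate_succ_apply', Function.iterate_succ_apply',
      h1]
    have h3 := tau_seg (tauPos^[d] x) (tau^[d] (seg x l)).length
    rwa [← h2] at h3

theorem length_tau (w : List Bool) : (tau w).length = w.length + 2 * w.count true := by
  induction w with
  | nil => rfl
  | cons b w ih =>
    rw [show tau (b :: w) = tauLetter b ++ tau w from rfl]
    cases b <;> simp [ih, tauLetter] <;> ring

theorem count_tau (w : List Bool) : (tau w).count true = w.length + w.count true := by
  induction w with
  | nil => rfl
  | cons b w ih =>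
    rw [show tau (b :: w) = tauLetter b ++ tau w from rfl]
    cases b <;> simp [ih, tauLetter] <;> ring

theorem tauPos_add (x l : ℕ) : tauPos (x + l) = tauPos x + (l + 2 * (seg x l).count true) := by
  rw [(tau_seg x l).1, length_tau, length_seg]

theorem count_seg_tauPos (x l : ℕ) :
    (seg (tauPos x) (l + 2 * (seg x l).count true)).count true = l + (seg x l).count true := by
  have h := (tau_seg x l).2
  rw [length_tau, length_seg] at h
  rw [← h, count_tau, length_seg]

theorem tauPos_succ (n : ℕ) : tauPos (n + 1) = tauPos n + if letter n then 3 else 1 := by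
  rw [tauPos_add, seg_one]
  cases letter n <;> simp

theorem tauPos_zero : tauPos 0 = 0 := rfl

theorem tauPos_strictMono : StrictMono tauPos :=
  strictMono_nat_of_lt_succ fun n => by rw [tauPos_succ]; split_ifs <;> omega

theorem letter_tauPos (n : ℕ) : letter (tauPos n) = true := by
  have h := (tau_seg n 1).2
  rw [seg_one] at h
  cases h1 : letter n <;> rw [h1] at h <;> simp [tau, tauLetter, seg, List.range_succ] at h
  · exact h
  · exact h.1

theorem letter_tauPos_one {n : ℕ} (hn : letter n = true) : letter (tauPos n + 1) = false := by
  have h := (tau_seg n 1).2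
  rw [seg_one, hn] at h
  simp [tau, tauLetter, seg, List.range_succ] at h
  exact h.2.1

theorem letter_tauPos_two {n : ℕ} (hn : letter n = true) : letter (tauPos n + 2) = true := by
  have h := (tau_seg n 1).2
  rw [seg_one, hn] at h
  simp [tau, tauLetter, seg, List.range_succ] at h
  exact h.2.2

theorem letter_tauPos_succ_sub_one (n : ℕ) : letter (tauPos (n + 1) - 1) = true := by
  rw [tauPos_succ]
  cases h : letter n
  · simp [letter_tauPos]
  · simp [letter_tauPos_two h]

/-- Every position lies in the image of exactly one letter. -/
theorem exists_tauPos_le_lt (t : ℕ) : ∃ n, tauPos n ≤ t ∧ t < tauPos (n + 1) := by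
  induction t with
  | zero => exact ⟨0, by simp [tauPos_zero], by rw [tauPos_succ, tauPos_zero]; split_ifs <;> simp⟩
  | succ t ih =>
    obtain ⟨n, h1, h2⟩ := ih
    by_cases h : t + 1 < tauPos (n + 1)
    · exact ⟨n, by omega, h⟩
    · refine ⟨n + 1, by omega, ?_⟩
      have := tauPos_strictMono (show n + 1 < n + 1 + 1 by omega)
      omega

/-- The image of a letter determines the letters of the fixed point in it. -/
theorem letter_tauPos_add_congr {n n' i : ℕ} (h : letter n = letter n')
    (hi : tauPos n + i < tauPos (n + 1)) : letter (tauPos n + i) = letter (tauPos n' + i) := by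
  rw [tauPos_succ] at hi
  cases h1 : letter n
  · rw [h1] at hi
    obtain rfl : i = 0 := by simp at hi; omega
    simp [letter_tauPos]
  · rw [h1] at hi h
    have : i = 0 ∨ i = 1 ∨ i = 2 := by simp at hi; omega
    rcases this with rfl | rfl | rfl
    · simp [letter_tauPos]
    · rw [letter_tauPos_one h1, letter_tauPos_one h.symm]
    · rw [letter_tauPos_two h1, letter_tauPos_two h.symm]

/-! ### Runs of period `f (2 * k)` -/

theorem seg_split {x x' l a b : ℕ} (hl : l = a + b) (hx : x' = x + a) :
    seg x l = seg x a ++ seg x' b := by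
  rw [hl, hx, seg_add]

theorem count_seg_split {x x' l a b : ℕ} (hl : l = a + b) (hx : x' = x + a) :
    (seg x l).count true = (seg x a).count true + (seg x' b).count true := by
  rw [seg_split hl hx, List.count_append]

/-- `IsPeriodRun k e x y z`: the fixed point has period `f_{2k}` strictly between the positions
`y` and `z = y + f_{2k+3} - 1`, and this run cannot be prolonged on either side: the letters in
positions `y` and `z` differ from those one period further inside. The run contains the word
`τ^k(1)` in position `x`, with a second period to the right of it. The position `e ≤ y` is where
the image under `τ^k` of a factor `10110` starts; it is at a distance from `y` that depends on `k`
only, which serves to identify `y`. The counts of the letter `1` are what makes the lengths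
computable when `τ` is applied. -/
structure IsPeriodRun (k e x y z : ℕ) : Prop where
  z_eq : z + 1 = y + f (2 * k + 3)
  le_y : e ≤ y
  dist : 2 * (y + 1) = 2 * e + f (2 * k + 1) + 2
  count_left : 2 * (seg e (y + 1 - e)).count true = f (2 * k) + 1
  count_run : (seg (y + 1) (f (2 * k + 3) - 2)).count true + 1 = f (2 * k + 2)
  y_lt : y < x
  le_z : x + 2 * f (2 * k) ≤ z
  word : seg x (f (2 * k)) = tau^[k] [true]
  period : ∀ t, y < t → t + f (2 * k) < z → letter (t + f (2 * k)) = letter t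
  letter_y : letter y = k.bodd
  letter_y_add : letter (y + f (2 * k)) = !k.bodd
  letter_z : letter z = k.bodd
  letter_z_sub : letter (z - f (2 * k)) = !k.bodd

theorem isPeriodRun_zero {N : ℕ} (h0 : letter N = true) (h1 : letter (N + 1) = false)
    (h2 : letter (N + 2) = true) (h3 : letter (N + 3) = true) (h4 : letter (N + 4) = false) :
    IsPeriodRun 0 N (N + 2) (N + 1) (N + 4) := by
  have f3 : f 3 = 4 := rfl
  have f2 : f 2 = 3 := rfl
  refine ⟨?_, ?_, ?_, ?_, ?_, ?_, ?_, ?_, ?_, ?_, ?_, ?_, ?_⟩ <;>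
    (try simp only [mul_zero, zero_add, f_zero, f_one, f3, f2, Nat.bodd_zero]) <;> try omega
  · rw [show N + 1 + 1 - N = 2 by omega]; simp [seg, List.range_succ, h0, h1]
  · simp [seg, List.range_succ, h2, h3, add_assoc]
  · simp [h2]
  · intro t ht ht'
    obtain rfl : t = N + 2 := by omega
    rw [add_assoc, h3, h2]
  · simp [add_assoc, h2]
  · simp [h3]



theorem length_tau_iter_true (k : ℕ) : (tau^[k] [true]).length = f (2 * k) := (f_even k).symm

theorem IsPeriodRun.add_le {k e x y z : ℕ} (h : IsPeriodRun k e x y z) :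
    y + 1 + f (2 * k) ≤ z := by
  have := h.y_lt
  have := h.le_z
  omega

/-- Two positions at distance `f_{2k}` in a run have images at distance `f_{2k+2}`. -/
theorem IsPeriodRun.tauPos_add {k e x y z : ℕ} (h : IsPeriodRun k e x y z) {t : ℕ} (hy : y < t)
    (hz : t + f (2 * k) ≤ z) : tauPos (t + f (2 * k)) = tauPos t + f (2 * k + 2) := by
  have key : ∀ d, y + 1 + d + f (2 * k) ≤ z → tauPos (y + 1 + d + f (2 * k)) + tauPos (y + 1)
      = tauPos (y + 1 + d) + tauPos (y + 1 + f (2 * k)) := by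
    intro d
    induction d with
    | zero => intro _; rw [add_zero, add_comm]
    | succ d ih =>
      intro hd
      have := ih (by omega)
      have hp := h.period (y + 1 + d) (by omega) (by omega)
      rw [show y + 1 + (d + 1) + f (2 * k) = y + 1 + d + f (2 * k) + 1 by ring,
        show y + 1 + (d + 1) = y + 1 + d + 1 by ring, tauPos_succ, tauPos_succ (y + 1 + d), hp]
      omega
  have hx : tauPos (x + f (2 * k)) = tauPos x + f (2 * k + 2) := by
    rw [(tau_seg x _).1, h.word, ← Function.iterate_succ_apply' tau, length_tau_iter_true]
    rfl
  obtain ⟨c, rfl⟩ := Nat.exists_eq_add_of_le h.y_lt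
  obtain ⟨d, rfl⟩ := Nat.exists_eq_add_of_le (show y + 1 ≤ t from hy)
  have h1 := key c (by have := h.le_z; omega)
  have h2 := key d hz
  simp only [Nat.succ_eq_add_one] at hx h1
  omega

theorem f_odd_succ' (j : ℕ) : f (2 * j + 3) = 2 * f (2 * j) + f (2 * j + 1) := by
  rw [f_odd_succ, f_even_succ]; ring

set_option maxHeartbeats 2000000 in
/-- Applying `τ` to a run of period `f_{2k}` gives one of period `f_{2k+2}`. The images of both
letters start and end with `1` and one of them is `1` itself, so that the image of the run is
prolonged by exactly one letter on each side. -/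
theorem IsPeriodRun.succ {k e x y z : ℕ} (h : IsPeriodRun k e x y z) :
    IsPeriodRun (k + 1) (tauPos e) (tauPos x) (tauPos (y + 1) - 2) (tauPos z + 1) := by
  have hf1 := f_even_succ k
  have hf2 := f_odd_succ' k
  have hf3 := f_even_succ (k + 1)
  have hf4 := f_odd_succ' (k + 1)
  have hfp := f_pos (2 * k)
  have hfp' := f_pos (2 * k + 1)
  have hz := h.z_eq
  have hey := h.le_y
  have hd := h.dist
  have hl := h.add_le
  have hmono := tauPos_strictMono.monotone
  have hr1 := h.tauPos_add (t := y + 1) (by omega) (by omega)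
  have hr2 := h.tauPos_add (t := z - f (2 * k)) (by omega) (by omega)
  rw [show z - f (2 * k) + f (2 * k) = z by omega] at hr2
  have hly := h.letter_y
  have hlya := h.letter_y_add
  have hlz := h.letter_z
  have hlzs := h.letter_z_sub
  have hcl := h.count_left
  have hcr := h.count_run
  -- positions and numbers of letters `1` of the images of the run and of the factor from `e` to `y`
  have hrun := TauHankel.tauPos_add (y + 1) (f (2 * k + 3) - 2)
  rw [show y + 1 + (f (2 * k + 3) - 2) = z by omega] at hrun
  have hleft := TauHankel.tauPos_add e (y + 1 - e)
  rw [show e + (y + 1 - e) = y + 1 by omega] at hleft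
  have hcrun := count_seg_tauPos (y + 1) (f (2 * k + 3) - 2)
  have hcleft := count_seg_tauPos e (y + 1 - e)
  have hlast := letter_tauPos_succ_sub_one y
  simp only [show 2 * (k + 1) = 2 * k + 2 by ring, show 2 * k + 2 + 1 = 2 * k + 3 by ring,
    show 2 * k + 2 + 2 = 2 * k + 4 by ring, show 2 * k + 2 + 3 = 2 * k + 5 by ring] at hf3 hf4
  have hy0 : 2 ≤ tauPos (y + 1) := by omega
  have hf30 : 2 ≤ f (2 * k + 3) := by omega
  refine ⟨?_, ?_, ?_, ?_, ?_, ?_, ?_, ?_, ?_, ?_, ?_, ?_, ?_⟩ <;>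
    try simp only [show 2 * (k + 1) = 2 * k + 2 by ring, show 2 * k + 2 + 1 = 2 * k + 3 by ring,
      show 2 * k + 2 + 2 = 2 * k + 4 by ring, show 2 * k + 2 + 3 = 2 * k + 5 by ring]
  · omega
  · omega
  · omega
  · rw [show tauPos (y + 1) - 2 + 1 - tauPos e = tauPos (y + 1) - 1 - tauPos e by omega]
    have : seg (tauPos e) (y + 1 - e + 2 * (seg e (y + 1 - e)).count true)
        = seg (tauPos e) (tauPos (y + 1) - 1 - tauPos e) ++ seg (tauPos (y + 1) - 1) 1 := by
      exact seg_split (by omega) (by omega)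
    rw [this, List.count_append, seg_one, hlast] at hcleft
    simp at hcleft
    omega
  · have arith : ∀ c u v : ℕ, c + 1 = u → 2 ≤ v → 1 + (v - 2 + c + 1) + 1 = u + v := by
      intros; omega
    have h1 := count_seg_split (x := tauPos (y + 1) - 2 + 1) (x' := tauPos (y + 1)) (a := 1)
      (l := f (2 * k + 5) - 2) (b := f (2 * k + 3) - 2
        + 2 * (seg (y + 1) (f (2 * k + 3) - 2)).count true + 1) (by omega) (by omega)
    have h2 := count_seg_split (x := tauPos (y + 1)) (x' := tauPos z) (b := 1) rfl hrun
    have h3 : (seg (tauPos (y + 1) - 2 + 1) 1).count true = 1 := by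
      have h4 : tauPos (y + 1) - 2 + 1 = tauPos (y + 1) - 1 := by omega
      rw [seg_one, h4, hlast]; rfl
    have h5 : (seg (tauPos z) 1).count true = 1 := by rw [seg_one, letter_tauPos]; rfl
    rw [h1, h3, h2, hcrun, h5, hf3]
    exact arith _ _ _ hcr hf30
  · have := hmono (show y + 1 ≤ x from h.y_lt)
    omega
  · have hy := h.y_lt
    have hz := h.le_z
    have h1 := h.tauPos_add (t := x) (by omega) (by omega)
    have h2 := h.tauPos_add (t := x + f (2 * k)) (by omega) (by omega)
    have := hmono hz
    rw [two_mul, ← add_assoc] at this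
    omega
  · have h1 := (tau_seg x (f (2 * k))).2
    rw [h.word, ← Function.iterate_succ_apply' tau, length_tau_iter_true] at h1
    exact h1.symm
  · intro t ht ht'
    rcases Nat.lt_or_ge t (tauPos (y + 1)) with hlt | hge
    -- the letter gained on the left: both letters end an image, hence are `1`
    · obtain rfl : t = tauPos (y + 1) - 1 := by omega
      rw [show tauPos (y + 1) - 1 + f (2 * k + 2) = tauPos (y + f (2 * k) + 1) - 1 by
        rw [show y + f (2 * k) + 1 = y + 1 + f (2 * k) by ring]; omega,
        letter_tauPos_succ_sub_one, letter_tauPos_succ_sub_one]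
    · obtain ⟨n, hn1, hn2⟩ := exists_tauPos_le_lt t
      have hn3 : y + 1 ≤ n := by
        by_contra hc
        have := hmono (show n + 1 ≤ y + 1 by omega)
        omega
      have hn4 : n ≤ z - f (2 * k) := by
        by_contra hc
        have := tauPos_strictMono (show z - f (2 * k) < n by omega)
        omega
      have hn5 := h.tauPos_add (t := n) (by omega) (by omega)
      rcases hn4.lt_or_eq with hn6 | rfl
      · obtain ⟨i, rfl⟩ := Nat.exists_eq_add_of_le hn1
        rw [show tauPos n + i + f (2 * k + 2) = tauPos (n + f (2 * k)) + i by omega]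
        exact (letter_tauPos_add_congr (h.period n (by omega) (by omega)).symm hn2).symm
      -- the letter gained on the right: both letters start an image, hence are `1`
      · obtain rfl : t = tauPos (z - f (2 * k)) := by omega
        rw [← hr2, letter_tauPos, letter_tauPos]
  · rw [tauPos_succ, hly]
    cases hk : k.bodd
    · obtain ⟨y', rfl⟩ : ∃ y', y = y' + 1 := ⟨y - 1, by omega⟩
      simpa [hk] using letter_tauPos_succ_sub_one y'
    · simpa [hk] using letter_tauPos_one (hly.trans hk)
  · rw [show tauPos (y + 1) - 2 + f (2 * k + 2) = tauPos (y + f (2 * k) + 1) - 2 by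
        rw [show y + f (2 * k) + 1 = y + 1 + f (2 * k) by ring]; omega, tauPos_succ, hlya]
    cases hk : k.bodd
    · simpa [hk] using letter_tauPos_one (hlya.trans (by simp [hk]))
    · have := letter_tauPos_succ_sub_one (y + f (2 * k) - 1)
      rw [show y + f (2 * k) - 1 + 1 = y + f (2 * k) by omega] at this
      simpa [hk] using this
  · cases hk : k.bodd
    · have h1 := tauPos_succ z
      rw [hlz, hk] at h1
      simp only [Bool.false_eq_true, if_false] at h1
      rw [← h1, letter_tauPos]; simp [hk]
    · rw [letter_tauPos_one (hlz.trans hk)]; simp [hk]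
  · rw [show tauPos z + 1 - f (2 * k + 2) = tauPos (z - f (2 * k)) + 1 by omega]
    cases hk : k.bodd
    · rw [letter_tauPos_one (hlzs.trans (by simp [hk]))]; simp [hk]
    · have h1 := tauPos_succ (z - f (2 * k))
      rw [hlzs, hk] at h1
      simp only [Bool.not_true, Bool.false_eq_true, if_false] at h1
      rw [← h1, letter_tauPos]; simp [hk]

/-! ### Digits and positions -/

/-- The digit conditions of an `f`-representation. -/
structure IsDigitSeq (a : ℕ → ℕ) : Prop where
  digit : ∀ i, a i = 0 ∨ a i = 1
  adj : ∀ i, a i * a (i + 1) = 0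
  even_gap : ∀ i, Even i → a i * a (i + 2) = 0

theorem IsDigitSeq.shift {a : ℕ → ℕ} (h : IsDigitSeq a) : IsDigitSeq fun i => a (i + 2) :=
  ⟨fun i => h.digit _, fun i => by simpa [add_right_comm] using h.adj (i + 2),
    fun i hi => h.even_gap (i + 2) (by simpa [Nat.even_add] using hi)⟩

theorem IsDigitSeq.eq_zero_succ {a : ℕ → ℕ} (h : IsDigitSeq a) {i : ℕ} (hi : a i = 1) :
    a (i + 1) = 0 := by simpa [hi] using h.adj i

theorem IsDigitSeq.eq_zero_add_two {a : ℕ → ℕ} (h : IsDigitSeq a) {i : ℕ} (hi : a i = 1)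
    (he : Even i) : a (i + 2) = 0 := by simpa [hi] using h.even_gap i he

theorem sum_range_two_mul_succ (a : ℕ → ℕ) (t d : ℕ) :
    ∑ i ∈ Finset.range (2 * (t + 1)), a i * f (i + 2 * d)
      = ∑ i ∈ Finset.range (2 * t), a (i + 2) * f (i + 2 * (d + 1))
        + (a 0 * f (2 * d) + a 1 * f (2 * d + 1)) := by
  rw [show 2 * (t + 1) = 2 * t + 1 + 1 by ring, Finset.sum_range_succ', Finset.sum_range_succ',
    add_assoc, add_comm (a (0 + 1) * _)]
  congr 1
  · refine Finset.sum_congr rfl fun i _ => ?_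
    rw [show i + 1 + 1 + 2 * d = i + 2 * (d + 1) by ring]
  · rw [zero_add, zero_add, add_comm 1]

/-- Shifting the digits of a number by `2 d` places applies `tauPos^[d]`, and the letter in
position `n` is `0` exactly if the lowest digit of `n` is `1`. -/
theorem sum_digits_shift (t : ℕ) : ∀ {a : ℕ → ℕ}, IsDigitSeq a →
    (∀ d, ∑ i ∈ Finset.range (2 * t), a i * f (i + 2 * d)
      = tauPos^[d] (∑ i ∈ Finset.range (2 * t), a i * f i)) ∧
    (0 < t → letter (∑ i ∈ Finset.range (2 * t), a i * f i) = decide (a 0 = 0)) ∧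
    (a 0 = 0 → letter (∑ i ∈ Finset.range (2 * t), a i * f i) = true) := by
  induction t with
  | zero =>
    intro a _
    refine ⟨fun d => ?_, by simp, fun _ => ?_⟩
    · have : Function.IsFixedPt tauPos 0 := tauPos_zero
      simp [(this.iterate d).eq]
    · simpa [tauPos_zero] using letter_tauPos 0
  | succ t ih =>
    intro a ha
    obtain ⟨h1, -, h3⟩ := ih ha.shift
    have hv : ∑ i ∈ Finset.range (2 * (t + 1)), a i * f i
        = tauPos (∑ i ∈ Finset.range (2 * t), a (i + 2) * f i) + (a 0 + 2 * a 1) := by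
      have := sum_range_two_mul_succ a t 0
      rw [zero_add, h1 1] at this
      simp only [mul_zero, add_zero, zero_add, f_zero, f_one, Function.iterate_one] at this
      rw [this]; ring
    have hl : letter (∑ i ∈ Finset.range (2 * (t + 1)), a i * f i) = decide (a 0 = 0) := by
      rw [hv]
      rcases ha.digit 0 with h0 | h0
      · rcases ha.digit 1 with h5 | h5
        · simp [h0, h5, letter_tauPos]
        · simpa [h0, h5] using letter_tauPos_two (h3 (ha.eq_zero_succ h5))
      · simpa [h0, ha.eq_zero_succ h0] using
          letter_tauPos_one (h3 (ha.eq_zero_add_two h0 Even.zero))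
    refine ⟨fun d => ?_, fun _ => hl, fun h => by simpa [h] using hl⟩
    rw [hv, sum_range_two_mul_succ, h1, (tau_iter_seg d _ _).1, ← Function.iterate_succ_apply]
    congr 1
    rcases ha.digit 0 with h0 | h0
    · rcases ha.digit 1 with h5 | h5
      · have : tau^[d] [] = [] := by
          have : Function.IsFixedPt tau [] := rfl
          exact (this.iterate d).eq
        simp [h0, h5, this]
      · have hs : seg (tauPos (∑ i ∈ Finset.range (2 * t), a (i + 2) * f i)) 2
            = [true, false] := by
          rw [show 2 = 1 + 1 from rfl, seg_add, seg_one, seg_one, letter_tauPos,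
            letter_tauPos_one (h3 (ha.eq_zero_succ h5))]
          rfl
        simp [h0, h5, hs, f_odd]
    · simp [h0, ha.eq_zero_succ h0, letter_tauPos, f_even]

theorem isDigitSeq_fDigits (n : ℕ) : IsDigitSeq (fDigits n) :=
  ⟨(isFRep_fDigits n).digit, (isFRep_fDigits n).adj, (isFRep_fDigits n).even_gap⟩

/-- A number with lowest digits `a_0 = 0` and `a_1 = 1` or `a_2 = 1` is the position of the
factor `11`. -/
theorem letter_succ_sum_digits {a : ℕ → ℕ} (ha : IsDigitSeq a) (t : ℕ) (h0 : a 0 = 0)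
    (h12 : a 1 = 1 ∨ a 2 = 1) :
    letter (∑ i ∈ Finset.range (2 * (t + 2)), a i * f i + 1) = true := by
  have hs := sum_range_two_mul_succ a (t + 1) 0
  obtain ⟨h1, h2, h3⟩ := sum_digits_shift (t + 1) ha.shift
  rw [zero_add, h1 1, h0] at hs
  simp only [mul_zero, add_zero, zero_add, f_one, Function.iterate_one, zero_mul] at hs
  have hsucc := tauPos_succ (∑ i ∈ Finset.range (2 * (t + 1)), a (i + 2) * f i)
  rw [show t + 2 = t + 1 + 1 from rfl, hs]
  rcases h12 with h | h
  · rw [h3 (ha.eq_zero_succ h)] at hsucc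
    simp only [if_true] at hsucc
    rw [h, one_mul, add_assoc, ← hsucc]
    exact letter_tauPos _
  · have h4 : a 1 = 0 := by simpa [h] using ha.adj 1
    rw [h2 (by omega)] at hsucc
    simp only [zero_add, h, one_ne_zero, decide_false, Bool.false_eq_true, if_false] at hsucc
    rw [h4, zero_mul, add_zero, ← hsucc]
    exact letter_tauPos _

/-- An element of `F''_k` is at distance `f_{2k+1} / 2` from the image under `τ^(k+1)` of a factor
`11`: its digits above `2k+2` are, after a shift by `2k+2` places, those of the position of such a
factor. -/
theorem exists_of_mem_F'' {k y : ℕ} (hy : y ∈ F'' k) :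
    ∃ N, letter N = true ∧ letter (N + 1) = true ∧
      y = f (2 * k + 1) / 2 + tauPos^[k] (tauPos N) := by
  obtain ⟨h1, h2⟩ := hy
  rw [F, Set.mem_ofPred_eq, Phi] at h1
  rw [F', Set.mem_ofPred_eq, Phi, show 2 * (k + 1) + 3 = 2 * k + 3 + 1 + 1 by ring,
    Finset.sum_range_succ, Finset.sum_range_succ, h1] at h2
  have ha := isDigitSeq_fDigits y
  set a : ℕ → ℕ := ⇑(fDigits y)
  -- the digits of `y` above `2k+2`, shifted by `2k` places
  let b : ℕ → ℕ := fun i => if i < 3 then 0 else a (i + 2 * k)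
  have hb : IsDigitSeq b := by
    refine ⟨fun i => ?_, fun i => ?_, fun i hi => ?_⟩
    · by_cases h : i < 3
      · simp [b, h]
      · simpa [b, h] using ha.digit _
    · by_cases h : i < 3
      · simp [b, h]
      · simpa [b, h, show ¬ i + 1 < 3 by omega, add_right_comm] using ha.adj (i + 2 * k)
    · by_cases h : i < 3
      · simp [b, h]
      · simpa [b, h, show ¬ i + 2 < 3 by omega, add_right_comm] using
          ha.even_gap (i + 2 * k) (by simpa [Nat.even_add] using hi)
  obtain ⟨t, ht⟩ : ∃ t, ∀ i, t ≤ i → a i = 0 := by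
    refine ⟨(fDigits y).support.sup id + 1, fun i hi => ?_⟩
    by_contra hc
    have := Finset.le_sup (f := id) (s := (fDigits y).support) (b := i)
      (Finsupp.mem_support_iff.mpr hc)
    simp only [id] at this
    omega
  have hsum : y = f (2 * k + 1) / 2 + tauPos^[k] (∑ i ∈ Finset.range (2 * (t + 3)), b i * f i) := by
    obtain ⟨q, hq⟩ : ∃ q, 2 * (t + 3) = 3 + q := ⟨2 * t + 3, by ring⟩
    rw [← (sum_digits_shift (t + 3) hb).1 k]
    conv_lhs => rw [(isFRep_fDigits y).sum_eq,
      sum_eq_range (fDigits y) (2 * k + 3 + q) (fun i hi => ht i (by omega)),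
      Finset.sum_range_add, h1]
    rw [hq, Finset.sum_range_add]
    congr 1
    rw [Finset.sum_eq_zero (s := Finset.range 3) (fun i hi => by simp [b, Finset.mem_range.mp hi]),
      zero_add]
    refine Finset.sum_congr rfl fun i _ => ?_
    simp only [b, show ¬ 3 + i < 3 by omega, if_false]
    rw [show 3 + i + 2 * k = 2 * k + 3 + i by ring]
  have hs := sum_range_two_mul_succ b (t + 2) 0
  rw [zero_add, (sum_digits_shift (t + 2) hb.shift).1 1] at hs
  simp only [mul_zero, add_zero, Function.iterate_one, show b 0 = 0 from rfl,
    show b 1 = 0 from rfl, zero_mul] at hs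
  refine ⟨∑ i ∈ Finset.range (2 * (t + 2)), b (i + 2) * f i,
    (sum_digits_shift (t + 2) hb.shift).2.2 rfl, letter_succ_sum_digits hb.shift t rfl ?_, ?_⟩
  · by_contra hc
    push Not at hc
    have h3 : a (2 * k + 3) = 0 := by
      have := hc.1
      simp only [b] at this
      rw [add_comm]
      exact (ha.digit _).resolve_right this
    have h4 : a (2 * k + 3 + 1) = 0 := by
      have := hc.2
      simp only [b] at this
      rw [show 2 * k + 3 + 1 = 2 + 2 + 2 * k by ring]
      exact (ha.digit _).resolve_right this
    rw [h3, h4] at h2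
    simp at h2
  · rw [← hs]; exact hsum

/-- Every element of `F''_k` is the position to the left of a run of period `f_{2k}`. -/
theorem exists_isPeriodRun {k y : ℕ} (hy : y ∈ F'' k) : ∃ e x z, IsPeriodRun k e x y z := by
  obtain ⟨N, h1, h2, hN⟩ := exists_of_mem_F'' hy
  have key : ∀ k, ∃ x y z, IsPeriodRun k (tauPos^[k] (tauPos N)) x y z := by
    intro k
    induction k with
    | zero =>
      have h3 := tauPos_succ N
      simp only [h1, if_true] at h3
      refine ⟨_, _, _, isPeriodRun_zero (letter_tauPos N) (letter_tauPos_one h1)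
        (letter_tauPos_two h1) ?_ ?_⟩
      · rw [Function.iterate_zero, id, ← h3, letter_tauPos]
      · rw [Function.iterate_zero, id, show tauPos N + 4 = tauPos (N + 1) + 1 by omega, letter_tauPos_one h2]
    | succ k ih =>
      obtain ⟨x, y, z, h⟩ := ih
      rw [Function.iterate_succ_apply']
      exact ⟨_, _, _, h.succ⟩
  obtain ⟨x, y', z, h⟩ := key k
  have hd := h.dist
  obtain ⟨q, hq⟩ := (f_parity k).2
  obtain rfl : y = y' := by omega
  exact ⟨_, _, _, h⟩

/-! ### Hankel determinants of a locally periodic sequence -/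

section Determinants

variable {R : Type*} [CommRing R]

theorem det_eq_of_column_single {n : ℕ} (A : Matrix (Fin (n + 1)) (Fin (n + 1)) R)
    (i₀ j₀ : Fin (n + 1)) (h : ∀ i, i ≠ i₀ → A i j₀ = 0) :
    A.det = (-1) ^ ((i₀ : ℕ) + (j₀ : ℕ)) * A i₀ j₀ *
      (A.submatrix i₀.succAbove j₀.succAbove).det := by
  rw [Matrix.det_succ_column A j₀, Finset.sum_eq_single i₀ (fun i _ hi => by rw [h i hi]; ring)
    (by simp)]

theorem val_succAbove_mk {n c : ℕ} (hc : c < n + 1) (j : Fin n) :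
    ((⟨c, hc⟩ : Fin (n + 1)).succAbove j : ℕ) = if (j : ℕ) < c then (j : ℕ) else j + 1 := by
  rw [Fin.succAbove]
  simp only [Fin.lt_def, Fin.val_castSucc]
  split_ifs <;> simp

/-- A matrix with three blocks of columns: the first `r` columns are those of the Hankel matrix of
`u` that starts with `u m`, the next `a` are those of the Hankel matrix of `d` that starts with
`d m`, and the others those of the Hankel matrix of `d` that starts with `d y`. -/
def blockHankel (u d : ℕ → R) (r a m y n : ℕ) : Matrix (Fin n) (Fin n) R :=
  Matrix.of fun i j => if (j : ℕ) < r then u (m + i + j)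
    else if (j : ℕ) < r + a then d (m + i + (j - r)) else d (y + i + (j - (r + a)))

/-- Column `r + a` has a single nonzero entry, in the first row. -/
theorem det_blockHankel_succ_left (u d : ℕ → R) (r a m y n : ℕ) (hn : r + a ≤ n)
    (h : ∀ i, 0 < i → i ≤ n → d (m + a + i) = 0) :
    (blockHankel u d r (a + 1) m y (n + 1)).det
      = (-1) ^ (r + a) * d (m + a) * (blockHankel u d r a (m + 1) (y + 1) n).det := by
  rw [det_eq_of_column_single _ 0 ⟨r + a, by omega⟩]
  · congr 1
    · simp [blockHankel]
    · congr 1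
      ext i j
      simp only [blockHankel, Matrix.submatrix_apply, Matrix.of_apply, Fin.zero_succAbove,
        Fin.val_succ, val_succAbove_mk]
      by_cases hj : (j : ℕ) < r + a
      · rw [if_pos hj, if_pos hj, if_pos (show (j : ℕ) < r + (a + 1) by omega)]
        split_ifs <;> congr 1 <;> ring
      · rw [if_neg hj, if_neg (by omega), if_neg (by omega), if_neg (by omega), if_neg hj]
        congr 1; omega
  · intro i hi
    have : (i : ℕ) ≠ 0 := fun h => hi (Fin.ext h)
    simp only [blockHankel, Matrix.of_apply]
    rw [if_neg (by omega), if_pos (by omega)]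
    have := h i (by omega) (by omega)
    rwa [show m + i + (r + a - r) = m + a + i by omega]

theorem det_blockHankel_left (u d : ℕ → R) (r a : ℕ) : ∀ m y n, r + a ≤ n →
    (∀ i, m + a ≤ i → i + 1 < m + a + n → d i = 0) →
    (blockHankel u d r a m y n).det
      = (-1) ^ (r * a + a.choose 2) * d (m + a - 1) ^ a *
        (blockHankel u d r 0 (m + a) (y + a) (n - a)).det := by
  induction a with
  | zero => intro m y n _ _; simp
  | succ a ih =>
    intro m y n hn h
    obtain ⟨n, rfl⟩ : ∃ n', n = n' + 1 := ⟨n - 1, by omega⟩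
    rw [det_blockHankel_succ_left u d r a m y n (by omega) fun i h1 h2 => h _ (by omega) (by omega),
      ih (m + 1) (y + 1) n (by omega) fun i h1 h2 => h _ (by omega) (by omega),
      Nat.choose_succ_succ' a 1, Nat.choose_one_right,
      show m + 1 + a - 1 = m + a by omega, show m + (a + 1) - 1 = m + a by omega,
      show m + 1 + a = m + (a + 1) by ring, show y + 1 + a = y + (a + 1) by ring,
      show n + 1 - (a + 1) = n - a by omega]
    ring

/-- Column `r` has a single nonzero entry, in the last row. -/
theorem det_blockHankel_succ_right (u d : ℕ → R) (r m y n : ℕ) (hn : r ≤ n)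
    (h : ∀ i, i < n → d (y + i) = 0) :
    (blockHankel u d r 0 m y (n + 1)).det
      = (-1) ^ (n + r) * d (y + n) * (blockHankel u d r 0 m (y + 1) n).det := by
  rw [det_eq_of_column_single _ (Fin.last n) ⟨r, by omega⟩]
  · congr 1
    · simp [blockHankel]
    · congr 1
      ext i j
      simp only [blockHankel, Matrix.submatrix_apply, Matrix.of_apply, Fin.succAbove_last,
        Fin.val_castSucc, val_succAbove_mk, add_zero]
      by_cases hj : (j : ℕ) < r
      · simp [hj]
      · rw [if_neg hj, if_neg (by omega), if_neg (by omega), if_neg (by omega), if_neg hj]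
        congr 1; omega
  · intro i hi
    have : (i : ℕ) ≠ n := fun h => hi (Fin.ext h)
    simp only [blockHankel, Matrix.of_apply]
    rw [if_neg (by omega), if_neg (by omega)]
    have := h i (by omega)
    rwa [show y + i + (r - (r + 0)) = y + i by omega]

theorem det_blockHankel_right (u d : ℕ → R) (r m b : ℕ) : ∀ y,
    (∀ i, y ≤ i → i + 1 < y + r + b → d i = 0) →
    (blockHankel u d r 0 m y (r + b)).det
      = (-1) ^ (b.choose 2) * d (y + r + b - 1) ^ b * (blockHankel u d r 0 m (y + b) r).det := by
  induction b with
  | zero => intro y _; simp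
  | succ b ih =>
    intro y h
    rw [← add_assoc, det_blockHankel_succ_right u d r m y (r + b) (by omega)
      fun i h1 => h _ (by omega) (by omega),
      ih (y + 1) fun i h1 h2 => h _ (by omega) (by omega),
      Nat.choose_succ_succ' b 1, Nat.choose_one_right,
      show y + 1 + r + b - 1 = y + (r + b) by omega, show y + r + (b + 1) - 1 = y + (r + b) by omega,
      show y + 1 + b = y + (b + 1) by ring]
    have : ((-1 : R)) ^ (r + b + r) = (-1) ^ b := by
      rw [show r + b + r = b + 2 * r by ring, pow_add, pow_mul]; simp
    rw [this]
    ring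

theorem blockHankel_self {S : Type*} (u d : ℕ → S) (r m y : ℕ) :
    blockHankel u d r 0 m y r = Matrix.of fun i j : Fin r => u (m + i + j) := by
  ext i j
  simp [blockHankel]

/-- Subtracting from each column the one `r` places before it does not change a Hankel
determinant. -/
theorem det_hankel_eq_sub (u : ℕ → R) {r : ℕ} (hr : 0 < r) (m n : ℕ) :
    (Matrix.of fun i j : Fin n => u (m + i + j)).det
      = (Matrix.of fun i j : Fin n => if (j : ℕ) < r then u (m + i + j)
          else u (m + i + (j - r) + r) - u (m + i + (j - r))).det := by
  let Q : Matrix (Fin n) (Fin n) R := Matrix.of fun l j => if (l : ℕ) + r = j then 1 else 0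
  have hT : (1 - Q).det = 1 := by
    rw [Matrix.det_of_isUpperTriangular]
    · refine Finset.prod_eq_one fun i _ => ?_
      simp [Q, hr.ne']
    · intro i j hij
      have : (j : ℕ) < i := hij
      simp [Q, show i ≠ j from fun h => by omega,
        show ¬ (i : ℕ) + r = j by omega]
  rw [← mul_one (Matrix.det _), ← hT, ← Matrix.det_mul, mul_sub, mul_one]
  congr 1
  ext i j
  simp only [Matrix.sub_apply, Matrix.mul_apply, Matrix.of_apply, Q, mul_ite, mul_one, mul_zero]
  split_ifs with h
  · rw [Finset.sum_eq_zero, sub_zero]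
    intro l _
    rw [if_neg (by omega)]
  · rw [Finset.sum_eq_single ⟨j - r, by omega⟩]
    · rw [if_pos (by simp; omega)]
      congr 2; omega
    · intro l _ hl
      rw [if_neg]
      intro h'
      exact hl (Fin.ext (by simp; omega))
    · simp

/-- If `u` has period `r` on an interval, then a Hankel determinant whose window reaches beyond
this interval by at most `a` places on the left and `b` on the right is, up to the sign and powers
of the two defects, the Hankel determinant of order `r` inside the interval. -/
theorem det_hankel_of_period (u : ℕ → R) {r : ℕ} (hr : 0 < r) (m a b : ℕ)
    (h : ∀ i, m + a ≤ i → i + 1 < m + a + (r + a + b) → u (i + r) = u i) :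
    (Matrix.of fun i j : Fin (r + a + b) => u (m + i + j)).det
      = (-1) ^ (r * a + a.choose 2 + b.choose 2) * (u (m + a - 1 + r) - u (m + a - 1)) ^ a
        * (u (m + a + (r + a + b) - 1 + r) - u (m + a + (r + a + b) - 1)) ^ b
        * (Matrix.of fun i j : Fin r => u (m + a + i + j)).det := by
  let d : ℕ → R := fun i => u (i + r) - u i
  have hd : ∀ i, m + a ≤ i → i + 1 < m + a + (r + a + b) → d i = 0 := fun i h1 h2 => by
    simp only [d]; rw [h i h1 h2, sub_self]
  have h1 : (Matrix.of fun i j : Fin (r + a + b) => if (j : ℕ) < r then u (m + i + j)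
      else u (m + i + (j - r) + r) - u (m + i + (j - r)))
        = blockHankel u d r a m (m + a) (r + a + b) := by
    ext i j
    simp only [blockHankel, Matrix.of_apply, d]
    split_ifs
    · rfl
    · rfl
    · congr 2 <;> omega
  rw [det_hankel_eq_sub u hr, h1, det_blockHankel_left u d r a m (m + a) _ (by omega) hd,
    show r + a + b - a = r + b by omega,
    det_blockHankel_right u d r (m + a) b (m + a + a) fun i h1 h2 => hd i (by omega) (by omega),
    blockHankel_self, show m + a + a + r + b - 1 = m + a + (r + a + b) - 1 by omega]
  simp only [d]
  ring

/-- If the period `r` leaves a whole column of differences inside the interval of periodicity,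
the Hankel determinant vanishes. -/
theorem det_hankel_eq_zero (u : ℕ → R) {r : ℕ} (hr : 0 < r) (m n c : ℕ) (hc : r + c < n)
    (h : ∀ i, i < n → u (m + c + i + r) = u (m + c + i)) :
    (Matrix.of fun i j : Fin n => u (m + i + j)).det = 0 := by
  rw [det_hankel_eq_sub u hr]
  refine Matrix.det_eq_zero_of_column_eq_zero ⟨r + c, hc⟩ fun i => ?_
  have := h i i.2
  rw [Matrix.of_apply, if_neg (by simp), show m + (i : ℕ) + (r + c - r) = m + c + i by omega,
    this, sub_self]

/-- The sign of the reversal of the order, read off from the determinant of the antidiagonal matrix,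
which is a `blockHankel` matrix with a single block. -/
theorem sign_revPerm (n : ℕ) : ((Equiv.Perm.sign (Fin.revPerm : Equiv.Perm (Fin n)) : ℤˣ) : ℤ)
    = (-1) ^ n.choose 2 := by
  have h := det_blockHankel_left (R := ℤ) 0 (fun i => if i + 1 = n then 1 else 0) 0 n 0 0 n
    (by omega) fun i h1 h2 => if_neg (by omega)
  have h2 : blockHankel (R := ℤ) 0 (fun i => if i + 1 = n then 1 else 0) 0 n 0 0 n
      = (1 : Matrix (Fin n) (Fin n) ℤ).submatrix id Fin.revPerm := by
    ext i j
    have : i = Fin.rev j ↔ (i : ℕ) + j + 1 = n := by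
      rw [Fin.ext_iff, Fin.val_rev]; omega
    simp [blockHankel, Matrix.one_apply, this]
  rw [h2, Matrix.det_permute', Matrix.det_one, mul_one, Int.cast_id, Nat.sub_self,
    Matrix.det_isEmpty, mul_one] at h
  rw [h]
  rcases Nat.eq_zero_or_pos n with rfl | hn
  · simp
  · simp [show n - 1 + 1 = n by omega]

end Determinants

/-! ### Circulant determinants -/

section Circulant

open Matrix

variable {r : ℕ} [NeZero r]

/-- The circulant matrix of `1 - x ^ u + c * (1 + x + ⋯ + x ^ (r - 1))`, where `x` is the cyclic
shift. -/
def shiftDiff (u : ZMod r) (c : ℚ) : Matrix (ZMod r) (ZMod r) ℚ :=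
  circulant fun i => (if i = 0 then 1 else 0) - (if i = u then 1 else 0) + c

/-- Multiplication by a unit permutes rows and columns and takes `1 - x` to `1 - x ^ u`. -/
theorem det_shiftDiff_unit (u : (ZMod r)ˣ) :
    (shiftDiff (u : ZMod r) 1).det = (shiftDiff (1 : ZMod r) 1).det := by
  rw [← det_submatrix_equiv_self u.mulLeft]
  congr 1
  ext i j
  have : (u : ZMod r) * (i - j) = u ↔ i - j = 1 :=
    ⟨fun h => u.isUnit.mul_left_cancel (h.trans (mul_one _).symm), fun h => by rw [h, mul_one]⟩
  simp [shiftDiff, circulant_apply, ← mul_sub, this]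

/-- Since `1 - x ^ u` is annihilated by the all-ones matrix, the coefficient `c` can be changed by a
factor `1 + κ * (all-ones)`, whose determinant is known. -/
theorem det_shiftDiff_smul (u : ZMod r) (c : ℚ) :
    (shiftDiff u c).det = c * (shiftDiff u 1).det := by
  have hr : (r : ℚ) ≠ 0 := Nat.cast_ne_zero.mpr (NeZero.ne r)
  have h1 : shiftDiff u c = shiftDiff u 1 *
      (1 + replicateCol Unit (fun _ : ZMod r => (c - 1) / r) *
        replicateRow Unit fun _ : ZMod r => (1 : ℚ)) := by
    have hrow : ∀ i : ZMod r, ∑ l, shiftDiff u 1 i l = r := by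
      intro i
      have := (Equiv.subLeft i).sum_comp fun t : ZMod r =>
        (if t = 0 then 1 else 0) - (if t = u then 1 else 0) + (1 : ℚ)
      simp only [shiftDiff, circulant_apply]
      simp only [Equiv.subLeft_apply] at this
      rw [this]
      simp [Finset.sum_add_distrib, Finset.sum_sub_distrib, ZMod.card]
    ext i j
    rw [mul_add, mul_one, Matrix.add_apply, ← Matrix.mul_assoc, mul_apply, Finset.sum_eq_single ()
      (by simp) (by simp), mul_apply]
    simp only [replicateCol_apply, replicateRow_apply, ← Finset.sum_mul, hrow]
    simp only [shiftDiff, circulant_apply]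
    field_simp
    ring
  rw [h1, det_mul, det_one_add_replicateCol_mul_replicateRow]
  simp [dotProduct, ZMod.card]
  field_simp
  ring

theorem det_shiftDiff_one_ne_zero : (shiftDiff (1 : ZMod r) 1).det ≠ 0 := by
  intro h
  have hr : (r : ℚ) ≠ 0 := Nat.cast_ne_zero.mpr (NeZero.ne r)
  -- a vector in the kernel is constant and has sum zero
  obtain ⟨v, hv, h⟩ := exists_mulVec_eq_zero_iff.mpr h
  have h1 : ∀ i, v i - v (i - 1) + ∑ l, v l = 0 := by
    intro i
    have := congrFun h i
    simp only [mulVec, dotProduct, shiftDiff, circulant_apply, add_mul, sub_mul, one_mul,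
      Finset.sum_add_distrib, Finset.sum_sub_distrib, ite_mul, zero_mul, Pi.zero_apply] at this
    rw [Finset.sum_eq_single i (fun l _ hl => by rw [if_neg (by rwa [sub_eq_zero, eq_comm])])
      (by simp), Finset.sum_eq_single (i - 1) (fun l _ hl => by
        rw [if_neg]; intro h'; exact hl (by rw [← h']; ring)) (by simp)] at this
    simpa using this
  have h2 : ∑ l, v l = 0 := by
    have := Finset.sum_eq_zero fun i (_ : i ∈ Finset.univ) => h1 i
    rw [Finset.sum_add_distrib, Finset.sum_sub_distrib,
      show ∑ i, v (i - 1) = ∑ i, v i from (Equiv.subRight (1 : ZMod r)).sum_comp v] at this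
    simpa [ZMod.card, hr] using this
  have h3 : ∀ n : ℕ, v (n : ZMod r) = v 0 := by
    intro n
    induction n with
    | zero => simp
    | succ n ih =>
      have := h1 ((n + 1 : ℕ) : ZMod r)
      rw [h2, Nat.cast_succ, add_sub_cancel_right] at this
      rw [Nat.cast_succ, ← ih]
      linarith
  have h4 : ∀ i, v i = v 0 := fun i => by simpa using h3 i.val
  rw [Finset.sum_congr rfl fun i _ => h4 i] at h2
  simp [ZMod.card, hr] at h2
  exact hv (funext fun i => by rw [h4, h2]; rfl)

/-- A permutation of odd order is even. -/
theorem sign_addRight (hr : Odd r) (a : ZMod r) : Equiv.Perm.sign (Equiv.addRight a) = 1 := by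
  have h1 : (Equiv.addRight a) ^ r = 1 := by
    ext i
    simp
  have h2 := congrArg Equiv.Perm.sign h1
  rw [map_pow, map_one] at h2
  rcases Int.units_eq_one_or (Equiv.Perm.sign (Equiv.addRight a)) with h | h
  · exact h
  · rw [h, hr.neg_one_pow] at h2
    exact absurd h2 (by decide)

/-- The determinant of the circulant matrix of a vector that some cyclic shift, by an amount prime
to `r`, changes in two places only, at distance prime to `r`. Multiplying by the matrix of
`1 - x ^ q + (1 + ⋯ + x ^ (r - 1))` gives that of
`x ^ a * (1 - x ^ u + (∑ w i) * (1 + ⋯ + x ^ (r - 1)))`. -/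
theorem det_circulant_of_swap (hr : Odd r) (w : ZMod r → ℚ) (q u : (ZMod r)ˣ) (a : ZMod r)
    (h : ∀ i, w i - w (i - q) = (if i = a then 1 else 0) - if i = a + u then 1 else 0) :
    (circulant w).det = ∑ i, w i := by
  have h1 : circulant w * shiftDiff (q : ZMod r) 1
      = (shiftDiff (u : ZMod r) (∑ i, w i)).submatrix (Equiv.addRight (-a)) id := by
    ext i j
    have hs : ∑ l, w (i - l) = ∑ l, w l := (Equiv.subLeft i).sum_comp w
    rw [mul_apply]
    simp only [shiftDiff, circulant_apply, submatrix_apply, mul_add, mul_sub, mul_ite, mul_one,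
      mul_zero, Finset.sum_add_distrib, Finset.sum_sub_distrib, hs, id]
    rw [Finset.sum_eq_single j (fun l _ hl => by rw [if_neg (by rwa [sub_eq_zero])])
      (by simp), Finset.sum_eq_single (j + q) (fun l _ hl => by
        rw [if_neg]; intro h'; exact hl (by rw [← h']; ring)) (by simp), if_pos (sub_self j),
      if_pos (by ring), show i - (j + (q : ZMod r)) = i - j - q by ring, h]
    have e1 : i - j = a ↔ Equiv.addRight (-a) i - j = 0 := by
      rw [Equiv.coe_addRight, ← sub_eq_zero]
      constructor <;> intro h <;> rw [← h] <;> ring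
    have e2 : i - j = a + u ↔ Equiv.addRight (-a) i - j = u := by
      rw [Equiv.coe_addRight, ← sub_eq_zero, ← sub_eq_zero (b := (u : ZMod r))]
      constructor <;> intro h <;> rw [← h] <;> ring
    simp only [e1, e2]
  have h2 := congrArg Matrix.det h1
  rw [det_mul, det_permute, sign_addRight hr, det_shiftDiff_smul (u : ZMod r) (∑ i, w i),
    det_shiftDiff_unit, det_shiftDiff_unit] at h2
  have h3 := det_shiftDiff_one_ne_zero (r := r)
  simpa [h3] using h2

/-- The residue map from `Fin r`. -/
noncomputable def finToZMod (r : ℕ) [NeZero r] : Fin r ≃ ZMod r :=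
  Equiv.ofBijective (fun i => ((i : ℕ) : ZMod r)) <| by
    rw [Fintype.bijective_iff_injective_and_card]
    refine ⟨fun i j hij => Fin.ext ?_, by simp [ZMod.card]⟩
    have := (ZMod.natCast_eq_natCast_iff' _ _ _).mp hij
    rwa [Nat.mod_eq_of_lt i.2, Nat.mod_eq_of_lt j.2] at this

theorem finToZMod_apply (i : Fin r) : finToZMod r i = ((i : ℕ) : ZMod r) := rfl

/-- Reversing the columns makes the Hankel matrix of a cyclic word a circulant matrix. -/
theorem det_hankel_eq_circulant (hr : Odd r) (w : ZMod r → ℚ) (x : ZMod r) :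
    (Matrix.of fun i j : Fin r => w (x + ((i : ℕ) : ZMod r) + ((j : ℕ) : ZMod r))).det
      = (-1) ^ r.choose 2 * (circulant w).det := by
  have h1 : ((Matrix.of fun i j : Fin r =>
      w (x + ((i : ℕ) : ZMod r) + ((j : ℕ) : ZMod r))).submatrix id Fin.revPerm)
      = ((circulant w).submatrix (Equiv.addRight (x - 1)) id).submatrix
        (finToZMod r) (finToZMod r) := by
    ext i j
    simp only [submatrix_apply, of_apply, circulant_apply, finToZMod_apply, id,
      Equiv.coe_addRight, Fin.revPerm_apply, Fin.val_rev]
    rw [Nat.cast_sub (by omega)]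
    congr 1
    push_cast
    simp
    ring
  have h2 := congrArg Matrix.det h1
  rw [det_permute', det_submatrix_equiv_self, det_permute, sign_addRight hr] at h2
  rw [show ((Equiv.Perm.sign (Fin.revPerm : Equiv.Perm (Fin r)) : ℤ) : ℚ)
    = (-1) ^ r.choose 2 by rw [sign_revPerm]; simp] at h2
  simp only [Units.val_one, Int.cast_one, one_mul] at h2
  rw [← h2, ← mul_assoc, ← mul_pow]
  simp

end Circulant

/-! ### The circulant determinant of `τ^k(1)` -/

/-- The words `τ^k(10)` and `τ^k(01)` differ by the exchange of two adjacent letters. -/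
theorem tau_iter_swap (k : ℕ) : ∃ (u v : List Bool) (b : Bool),
    tau^[k] [true, false] = u ++ [b, !b] ++ v ∧ tau^[k] [false, true] = u ++ [!b, b] ++ v := by
  induction k with
  | zero => exact ⟨[], [], true, rfl, rfl⟩
  | succ k ih =>
    obtain ⟨u, v, b, h1, h2⟩ := ih
    refine ⟨tau u ++ [true], [true] ++ tau v, !b, ?_, ?_⟩
    · rw [Function.iterate_succ_apply', h1, tau_append, tau_append]
      cases b <;> simp [tau, tauLetter]
    · rw [Function.iterate_succ_apply', h2, tau_append, tau_append]
      cases b <;> simp [tau, tauLetter]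

theorem coprime_f (k : ℕ) : Nat.Coprime (f (2 * k)) (f (2 * k + 2)) := by
  induction k with
  | zero => simp [f_zero]
  | succ k ih =>
    have h1 := f_even_succ (k + 1)
    have h2 := f_odd_succ k
    rw [show 2 * (k + 1) = 2 * k + 2 by ring] at h1 ⊢
    rw [h1, h2, Nat.coprime_self_add_right, Nat.coprime_add_self_right]
    exact ih.symm

theorem two_mul_count_tau_iter (k : ℕ) : 2 * (tau^[k] [true]).count true = f (2 * k + 1) := by
  induction k with
  | zero => rfl
  | succ k ih =>
    rw [Function.iterate_succ_apply', count_tau, length_tau_iter_true,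
      show 2 * (k + 1) + 1 = 2 * k + 3 by ring, f_odd_succ', ← ih]
    ring

/-- The indicator of the letter `1` in a word whose positions are read modulo `r`. -/
def cyclicWord (w : List Bool) (r : ℕ) : ZMod r → ℚ :=
  fun i => if w.getD i.val false then 1 else 0

theorem sum_cyclicWord {w : List Bool} {r : ℕ} [NeZero r] (hw : w.length = r) :
    ∑ i, cyclicWord w r i = w.count true := by
  subst hw
  rw [← (finToZMod w.length).sum_comp]
  have h1 : ∀ i : Fin w.length, cyclicWord w w.length (finToZMod _ i)
      = (fun b : Bool => if b then (1 : ℚ) else 0) w[(i : ℕ)] := by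
    intro i
    rw [cyclicWord, finToZMod_apply, ZMod.val_natCast, Nat.mod_eq_of_lt i.2,
      List.getD_eq_getElem _ _ i.2]
  rw [Finset.sum_congr rfl fun i _ => h1 i]
  refine (Fin.sum_univ_fun_getElem w fun b : Bool => if b then (1 : ℚ) else 0).trans ?_
  clear h1
  induction w with
  | nil => simp
  | cons b w ih =>
    cases b <;> simp_all [add_comm]

/-- The circulant determinant of `τ^k(1)` is its number of letters `1`. -/
theorem det_circulant_tau (k : ℕ) [NeZero (f (2 * k))] :
    (Matrix.circulant (cyclicWord (tau^[k] [true]) (f (2 * k)))).det = (f (2 * k + 1) : ℚ) / 2 := by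
  have hodd := (f_parity k).1
  have hsum : ∑ i, cyclicWord (tau^[k] [true]) (f (2 * k)) i = (f (2 * k + 1) : ℚ) / 2 := by
    rw [sum_cyclicWord (length_tau_iter_true k), ← two_mul_count_tau_iter]
    push_cast; ring
  rw [← hsum]
  cases k with
  | zero =>
    -- here `r = 1`, and all positions coincide
    have hsub : Subsingleton (ZMod (f (2 * 0))) := inferInstanceAs (Subsingleton (Fin 1))
    refine det_circulant_of_swap hodd _ 1 1 0 fun i => ?_
    rw [if_pos (Subsingleton.elim _ _), if_pos (Subsingleton.elim _ _),
      Subsingleton.elim (i - _) i]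
    ring
  | succ k =>
    obtain ⟨u, v, b, h1, h2⟩ := tau_iter_swap k
    set W := tau^[k + 1] [true] with hW
    set r := f (2 * (k + 1)) with hr
    have hlen : W.length = r := length_tau_iter_true (k + 1)
    have hW1 : W = u ++ [b, !b] ++ (v ++ tau^[k] [true]) := by
      rw [← List.append_assoc, ← h1, ← tau_iter_append]; rfl
    have hW2 : W.rotate (f (2 * k)) = u ++ [!b, b] ++ (v ++ tau^[k] [true]) := by
      have : W = tau^[k] [true] ++ tau^[k] [false, true] := tau_iter_true k
      rw [this, ← length_tau_iter_true, List.rotate_append_length_eq, h2]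
      simp
    -- the rotation by `f_{2k}` exchanges the first two words of `τ^k(1) τ^k(0) τ^k(1)`
    have hq : IsUnit ((f (2 * k) : ℕ) : ZMod r) :=
      (ZMod.isUnit_iff_coprime _ _).mpr (coprime_f k)
    obtain ⟨q, hq⟩ := hq
    have hrot : ∀ i : ZMod r, cyclicWord W r (i + q)
        = if (W.rotate (f (2 * k))).getD i.val false then 1 else 0 := by
      intro i
      have hi : i.val < W.length := by rw [hlen]; exact ZMod.val_lt i
      rw [List.getD_eq_getElem _ _ (by simpa using hi), List.getElem_rotate, cyclicWord, hq,
        List.getD_eq_getElem _ _ (by rw [hlen]; exact ZMod.val_lt _)]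
      have : (i + ((f (2 * k) : ℕ) : ZMod r)).val = (i.val + f (2 * k)) % W.length := by
        rw [hlen, ZMod.val_add, ZMod.val_natCast, Nat.add_mod_mod]
      simp only [this]
    have hul : u.length + 1 < r := by
      rw [← hlen, hW1]; simp
    have hval : ∀ (i : ZMod r) (n : ℕ), n < r → (i = (n : ZMod r) ↔ i.val = n) := by
      intro i n hn
      constructor
      · rintro rfl
        exact ZMod.val_natCast_of_lt hn
      · intro h
        rw [← h, ZMod.natCast_zmod_val]
    have hdiff : ∀ i : ZMod r, cyclicWord W r i - cyclicWord W r (i + q)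
        = (if b then 1 else -1) * ((if i = (u.length : ZMod r) then 1 else 0)
          - if i = ((u.length + 1 : ℕ) : ZMod r) then 1 else 0) := by
      intro i
      simp only [hval i _ (show u.length < r by omega), hval i _ hul]
      rw [hrot, cyclicWord, hW2]
      conv_lhs => rw [hW1]
      generalize i.val = n
      rcases lt_trichotomy n u.length with hn | rfl | hn
      · rw [List.getD_append _ _ _ _ (by simp; omega), List.getD_append _ _ _ _ hn,
          List.getD_append _ _ _ _ (by simp; omega), List.getD_append _ _ _ _ hn,
          if_neg (show ¬ n = u.length by omega), if_neg (show ¬ n = u.length + 1 by omega)]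
        simp
      · cases b <;> simp
      · obtain ⟨d, rfl⟩ := Nat.exists_eq_add_of_lt hn
        rcases d with _ | d
        · cases b <;> simp
        · rw [List.getD_append_right (u ++ [b, !b]) _ _ _ (by simp),
            List.getD_append_right (u ++ [!b, b]) _ _ _ (by simp),
            if_neg (show ¬ u.length + (d + 1) + 1 = u.length by omega),
            if_neg (show ¬ u.length + (d + 1) + 1 = u.length + 1 by omega)]
          simp
    cases b
    · refine det_circulant_of_swap hodd _ (-q) (-1) ((u.length + 1 : ℕ) : ZMod r) fun i => ?_
      rw [Units.val_neg, sub_neg_eq_add, hdiff, Units.val_neg, Units.val_one, Nat.cast_add,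
        Nat.cast_one, add_neg_cancel_right]
      simp
    · refine det_circulant_of_swap hodd _ (-q) 1 (u.length : ZMod r) fun i => ?_
      rw [Units.val_neg, sub_neg_eq_add, hdiff, Units.val_one, Nat.cast_add, Nat.cast_one]
      simp

/-- Within a run, letters at a distance divisible by the period agree. -/
theorem IsPeriodRun.letter_add_mul {k e x y z : ℕ} (h : IsPeriodRun k e x y z) {t : ℕ}
    (hy : y < t) (n : ℕ) (hz : t + f (2 * k) * n < z) : letter (t + f (2 * k) * n) = letter t := by
  induction n with
  | zero => simp
  | succ n ih =>
    rw [Nat.mul_succ, ← add_assoc] at hz ⊢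
    rw [h.period _ (by omega) hz]
    exact ih (by omega)

/-- Inside the run, the fixed point is the periodic continuation of `τ^k(1)`. -/
theorem IsPeriodRun.s_eq {k e x y z : ℕ} [NeZero (f (2 * k))] (h : IsPeriodRun k e x y z) {t : ℕ}
    (hy : y < t) (hz : t < z) :
    (s t : ℚ) = cyclicWord (tau^[k] [true]) (f (2 * k)) ((t : ZMod (f (2 * k))) - x) := by
  set i := ((t : ZMod (f (2 * k))) - x).val with hi
  have hir : i < f (2 * k) := ZMod.val_lt _
  have hx : letter (x + i) = (tau^[k] [true]).getD i false := by
    rw [← h.word, List.getD_eq_getElem _ _ (by simpa using hir), getElem_seg]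
  have ht : letter t = letter (x + i) := by
    have hmod : t ≡ x + i [MOD f (2 * k)] := by
      rw [← ZMod.natCast_eq_natCast_iff, Nat.cast_add, hi, ZMod.natCast_zmod_val]; ring
    have h1 := h.y_lt
    have h2 := h.le_z
    rcases le_total t (x + i) with hle | hle
    · obtain ⟨n, hn⟩ := (Nat.modEq_iff_dvd' hle).mp hmod
      have h3 : x + i = t + f (2 * k) * n := by omega
      rw [h3, h.letter_add_mul hy n (by omega)]
    · obtain ⟨n, hn⟩ := (Nat.modEq_iff_dvd' hle).mp hmod.symm
      have h3 : t = x + i + f (2 * k) * n := by omega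
      rw [h3, h.letter_add_mul (by omega) n (by omega)]
  rw [s_eq_letter, ht, hx, cyclicWord]
  split_ifs <;> simp

/-- The Hankel determinants of order `f_{2k}` inside the run. -/
theorem IsPeriodRun.H_eq {k e x y z : ℕ} (h : IsPeriodRun k e x y z) {m : ℕ} (hy : y < m)
    (hz : m + 2 * f (2 * k) ≤ z + 1) :
    H m (f (2 * k)) = (-1) ^ (f (2 * k)).choose 2 * ((f (2 * k + 1) : ℤ) / 2) := by
  have : NeZero (f (2 * k)) := ⟨(f_pos _).ne'⟩
  have h1 := det_hankel_eq_circulant (f_parity k).1 (cyclicWord (tau^[k] [true]) (f (2 * k)))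
    ((m : ZMod (f (2 * k))) - x)
  rw [det_circulant_tau] at h1
  have h2 : (Matrix.of fun i j : Fin (f (2 * k)) => cyclicWord (tau^[k] [true]) (f (2 * k))
      ((m : ZMod (f (2 * k))) - x + ((i : ℕ) : ZMod (f (2 * k))) + ((j : ℕ) : ZMod (f (2 * k)))))
      = (Matrix.of fun i j : Fin (f (2 * k)) => s (m + (i : ℕ) + (j : ℕ))).map
        (Int.castRingHom ℚ) := by
    ext i j
    rw [Matrix.map_apply, Matrix.of_apply, Matrix.of_apply, eq_intCast,
      h.s_eq (by omega) (by omega)]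
    congr 1
    push_cast
    ring
  rw [h2, ← RingHom.mapMatrix_apply, ← RingHom.map_det] at h1
  have h3 : ((H m (f (2 * k)) : ℤ) : ℚ) = (-1) ^ (f (2 * k)).choose 2 * (f (2 * k + 1) / 2) := h1
  obtain ⟨c, hc⟩ := (f_parity k).2
  rw [hc] at h3 ⊢
  push_cast at h3 ⊢
  rw [show ((c : ℤ) + c) / 2 = c by omega]
  rw [show ((c : ℚ) + c) / 2 = c by ring] at h3
  exact_mod_cast h3

/-! ### The four sides of the parallelogram -/

theorem neg_one_pow_eq_of_mod {a b : ℕ} (h : a % 2 = b % 2) : (-1 : ℤ) ^ a = (-1) ^ b := by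
  rw [← Nat.div_add_mod a 2, ← Nat.div_add_mod b 2, h, pow_add, pow_add, pow_mul, pow_mul]
  simp

theorem choose_two_mod_two (n : ℕ) : n.choose 2 % 2 = n / 2 % 2 := by
  induction n with
  | zero => rfl
  | succ n ih =>
    rw [Nat.choose_succ_succ' n 1, Nat.choose_one_right, one_add_one_eq_two]
    have : n % 4 = 0 ∨ n % 4 = 1 ∨ n % 4 = 2 ∨ n % 4 = 3 := by omega
    omega

/-- This parity is where the sign `(-1) ^ (k + 1)` comes from. -/
theorem f_half_mod_two (k : ℕ) : f (2 * k + 1) / 2 % 2 = (k + 1) % 2 := by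
  induction k with
  | zero => rfl
  | succ k ih =>
    have h1 := f_odd_succ' k
    obtain ⟨c, hc⟩ := (f_parity k).1
    obtain ⟨d, hd⟩ := (f_parity k).2
    rw [show 2 * (k + 1) + 1 = 2 * k + 3 by ring, h1]
    omega

/-- The Hankel determinants on the boundary of the parallelogram of a run. A window there reaches
beyond the run by `a` places on the left and `b` on the right; the two defects of periodicity
that occur are `(-1) ^ k` and `(-1) ^ (k + 1)`. -/
theorem IsPeriodRun.H_boundary {k e x y z : ℕ} (h : IsPeriodRun k e x y z) {m n a b : ℕ}
    (hn : n = f (2 * k) + a + b) (hy : y < m + a)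
    (hz : m + a + n ≤ y + f (2 * k) + f (2 * k + 1))
    (ha : 0 < a → m + a = y + 1) (hb : 0 < b → m + a + n = y + f (2 * k) + f (2 * k + 1)) :
    H m n = (-1) ^ (f (2 * k) * a + a.choose 2 + b.choose 2 + k * a + (k + 1) * b
      + (f (2 * k)).choose 2) * ((f (2 * k + 1) : ℤ) / 2) := by
  have hzz := h.z_eq
  have hf := f_odd_succ' k
  have hpos := f_pos (2 * k)
  have hbodd : ∀ k : ℕ, (if k.bodd then (-1 : ℤ) else 1) = (-1) ^ k := by
    intro k
    induction k with
    | zero => rfl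
    | succ k ih =>
      rw [pow_succ, ← ih, Nat.bodd_succ]
      cases k.bodd <;> rfl
  have h1 : (s (m + a - 1 + f (2 * k)) - s (m + a - 1)) ^ a = ((-1) ^ k) ^ a := by
    rcases Nat.eq_zero_or_pos a with rfl | ha'
    · simp
    · rw [ha ha', Nat.add_sub_cancel, s_eq_letter, s_eq_letter, h.letter_y, h.letter_y_add, ← hbodd]
      cases k.bodd <;> rfl
  have h2 : (s (m + a + (f (2 * k) + a + b) - 1 + f (2 * k))
      - s (m + a + (f (2 * k) + a + b) - 1)) ^ b = ((-1) ^ (k + 1)) ^ b := by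
    rcases Nat.eq_zero_or_pos b with rfl | hb'
    · simp
    · have := hb hb'
      rw [show m + a + (f (2 * k) + a + b) - 1 + f (2 * k) = z by omega,
        show m + a + (f (2 * k) + a + b) - 1 = z - f (2 * k) by omega,
        s_eq_letter, s_eq_letter, h.letter_z, h.letter_z_sub, pow_succ, ← hbodd]
      cases k.bodd <;> rfl
  have h3 := h.H_eq (m := m + a) hy (by omega)
  have h4 := det_hankel_of_period s hpos m a b fun i h5 h6 => by
    rw [s_eq_letter, s_eq_letter, h.period i (by omega) (by omega)]
  subst hn
  rw [H, h4, h1, h2]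
  rw [H] at h3
  rw [h3]
  ring

/-- Below the top and above the bottom side of the parallelogram of a run, the Hankel determinants
vanish except on its two other sides. -/
theorem IsPeriodRun.H_eq_zero {k e x y z : ℕ} (h : IsPeriodRun k e x y z) {m n : ℕ}
    (hn : n + 1 < f (2 * k + 2)) (h1 : y + f (2 * k) + 1 < m + n)
    (h2 : m + n < y + f (2 * k) + f (2 * k + 1)) (hn' : f (2 * k) < n) : H m n = 0 := by
  have hzz := h.z_eq
  have hf := f_odd_succ' k
  have hf' := f_even_succ k
  refine det_hankel_eq_zero s (f_pos (2 * k)) m n (y + 1 - m) (by omega) fun i hi => ?_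
  rw [s_eq_letter, s_eq_letter, h.period _ (by omega) (by omega)]

/-- The top side, where `n = f_{2k+2} - 1` and `a + b = f_{2k+1} - 1`. -/
theorem IsPeriodRun.H_top {k e x y z : ℕ} (h : IsPeriodRun k e x y z) {m n : ℕ}
    (hn : n = f (2 * k + 2) - 1) (h1 : y + f (2 * k) < m + n)
    (h2 : m + n ≤ y + f (2 * k) + f (2 * k + 1)) :
    H m n = (-1) ^ ((f (2 * k + 2) + f (2 * k + 1) - 3) / 2) * ((f (2 * k + 1) : ℤ) / 2) := by
  have hf' := f_even_succ k
  have hpos := f_pos (2 * k + 1)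
  rw [h.H_boundary (a := y + 1 - m) (b := f (2 * k + 1) - 1 - (y + 1 - m)) (by omega) (by omega)
    (by omega) (by omega) (by omega)]
  congr 1
  apply neg_one_pow_eq_of_mod
  have hh := f_half_mod_two k
  obtain ⟨c, hc⟩ := (f_parity k).1
  obtain ⟨d, hd⟩ := (f_parity k).2
  obtain ⟨a, ha⟩ : ∃ a, a = y + 1 - m := ⟨_, rfl⟩
  obtain ⟨b, hb⟩ : ∃ b, b = f (2 * k + 1) - 1 - (y + 1 - m) := ⟨_, rfl⟩
  rw [← hb, ← ha]
  have h3 := choose_two_mod_two a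
  have h4 := choose_two_mod_two b
  have h5 := choose_two_mod_two (f (2 * k))
  have h6 : f (2 * k) * a % 2 = a % 2 := by rw [hc, add_mul, mul_assoc]; omega
  -- `a + b` is odd
  have h7 : (k * a + (k + 1) * b) % 2 = (k + b) % 2 := by
    have h8 : k * a + (k + 1) * b = k * (2 * d - 1) + b := by
      rw [show 2 * d - 1 = a + b by omega]; ring
    obtain ⟨d, rfl⟩ : ∃ d', d = d' + 1 := ⟨d - 1, by omega⟩
    rw [h8, show 2 * (d + 1) - 1 = 2 * d + 1 by omega, show k * (2 * d + 1) + b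
      = 2 * (k * d) + (k + b) by ring]
    omega
  omega

/-- The bottom side, where the whole window lies in the run. -/
theorem IsPeriodRun.H_bottom {k e x y z : ℕ} (h : IsPeriodRun k e x y z) {m n : ℕ}
    (hn : n = f (2 * k)) (h1 : y + f (2 * k) < m + n)
    (h2 : m + n ≤ y + f (2 * k) + f (2 * k + 1)) :
    H m n = (-1) ^ (k + 1) * (-1) ^ ((f (2 * k + 2) - 1) / 2) * ((f (2 * k + 1) : ℤ) / 2) := by
  rw [h.H_boundary (a := 0) (b := 0) (by omega) (by omega) (by omega) (by omega) (by omega),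
    ← pow_add]
  congr 1
  apply neg_one_pow_eq_of_mod
  have hf' := f_even_succ k
  have hh := f_half_mod_two k
  obtain ⟨c, hc⟩ := (f_parity k).1
  obtain ⟨d, hd⟩ := (f_parity k).2
  have h5 := choose_two_mod_two (f (2 * k))
  simp only [mul_zero, Nat.choose_zero_succ, add_zero, zero_add]
  omega

/-- The left side, where `b = 0`, and the right side, where `a = 0`. -/
theorem IsPeriodRun.H_side {k e x y z : ℕ} (h : IsPeriodRun k e x y z) {m n : ℕ}
    (hn : f (2 * k) ≤ n) (hn' : n < f (2 * k + 2))
    (h1 : m + n = y + f (2 * k) + 1 ∨ m + n = y + f (2 * k) + f (2 * k + 1)) :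
    H m n = (-1) ^ ((f (2 * k + 2) + f (2 * k + 1) - 3) / 2)
      * (-1) ^ ((f (2 * k + 2) - 1 - n) * (k + 1))
      * (-1) ^ ((f (2 * k + 2) - 1 - n) * (f (2 * k + 2) - 2 - n) / 2)
      * ((f (2 * k + 1) : ℤ) / 2) := by
  have hf' := f_even_succ k
  have hpos := f_pos (2 * k + 1)
  have hh := f_half_mod_two k
  obtain ⟨c, hc⟩ := (f_parity k).1
  obtain ⟨d, hd⟩ := (f_parity k).2
  obtain ⟨M, hM⟩ : ∃ M, M = f (2 * k + 2) - 1 - n := ⟨_, rfl⟩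
  obtain ⟨N, hN⟩ : ∃ N, n = f (2 * k) + N := Nat.exists_eq_add_of_le hn
  have hT : (f (2 * k + 2) - 1 - n) * (f (2 * k + 2) - 2 - n) / 2 = M.choose 2 := by
    rw [Nat.choose_two_right, hM]; congr 2; omega
  rw [hT, ← hM, ← pow_add, ← pow_add]
  have h3 := choose_two_mod_two M
  have h4 := choose_two_mod_two N
  have h5 := choose_two_mod_two (f (2 * k))
  have h6 : f (2 * k) * N % 2 = N % 2 := by rw [hc, add_mul, mul_assoc]; omega
  have h7 : (M * (k + 1) + k * N) % 2 = (k + M) % 2 := by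
    obtain ⟨d, rfl⟩ : ∃ d', d = d' + 1 := ⟨d - 1, by omega⟩
    have h8 : M * (k + 1) + k * N = 2 * (k * d) + (k + M) := by
      have : M + N = 2 * d + 1 := by omega
      calc M * (k + 1) + k * N = k * (M + N) + M := by ring
        _ = _ := by rw [this]; ring
    rw [h8]; omega
  have key : (f (2 * k) * N + N.choose 2 + k * N + (f (2 * k)).choose 2) % 2
      = ((f (2 * k + 2) + f (2 * k + 1) - 3) / 2 + M * (k + 1) + M.choose 2) % 2 := by
    omega
  rcases h1 with h1 | h1
  · rw [h.H_boundary (a := N) (b := 0) (by omega) (by omega) (by omega) (by omega) (by omega)]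
    congr 1
    apply neg_one_pow_eq_of_mod
    simpa only [mul_zero, Nat.choose_zero_succ, add_zero] using key
  · rw [h.H_boundary (a := 0) (b := N) (by omega) (by omega) (by omega) (by omega) (by omega)]
    congr 1
    apply neg_one_pow_eq_of_mod
    rw [← key]
    simp only [mul_zero, Nat.choose_zero_succ, add_zero, zero_add, add_mul, one_mul]
    clear * - h6
    omega

theorem exists_isPeriodRun_beta' (k i : ℕ) : ∃ e x z, IsPeriodRun k e x (beta' k i) z :=
  exists_isPeriodRun (Nat.nth_mem_of_infinite (p := fun y => y ∈ F'' k) (infinite_F'' k) (i - 1))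

end TauHankel

theorem theorem2 (k m n : ℕ) (hmn : (m, n) ∈ TauHankel.V k) :
    (n = TauHankel.f (2 * k + 2) - 1 →
      TauHankel.H m n =
        (-1) ^ ((TauHankel.f (2 * k + 2) + TauHankel.f (2 * k + 1) - 3) / 2)
          * ((TauHankel.f (2 * k + 1) : ℤ) / 2)) ∧
    (n = TauHankel.f (2 * k) →
      TauHankel.H m n =
        (-1) ^ (k + 1) * (-1) ^ ((TauHankel.f (2 * k + 2) - 1) / 2)
          * ((TauHankel.f (2 * k + 1) : ℤ) / 2)) ∧
    (TauHankel.f (2 * k) < n → n < TauHankel.f (2 * k + 2) - 1 →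
      ((∃ i ≥ 1, m + n = TauHankel.beta k i + 1 ∨
          m + n = TauHankel.beta k i + TauHankel.f (2 * k + 1)) →
        TauHankel.H m n =
          (-1) ^ ((TauHankel.f (2 * k + 2) + TauHankel.f (2 * k + 1) - 3) / 2)
            * (-1) ^ ((TauHankel.f (2 * k + 2) - 1 - n) * (k + 1))
            * (-1) ^ ((TauHankel.f (2 * k + 2) - 1 - n) * (TauHankel.f (2 * k + 2) - 2 - n) / 2)
            * ((TauHankel.f (2 * k + 1) : ℤ) / 2)) ∧
      ((¬ ∃ i ≥ 1, m + n = TauHankel.beta k i + 1 ∨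
          m + n = TauHankel.beta k i + TauHankel.f (2 * k + 1)) →
        TauHankel.H m n = 0)) := by
  obtain ⟨i, hi⟩ := Set.mem_iUnion.mp hmn
  obtain ⟨hi0, hn1, hn2, hi1, hi2⟩ := Set.mem_iUnion.mp hi
  obtain ⟨e, x, z, h⟩ := TauHankel.exists_isPeriodRun_beta' k i
  simp only [TauHankel.beta] at hn1 hn2 hi1 hi2 ⊢
  refine ⟨fun hn => h.H_top hn (by omega) (by omega), fun hn => h.H_bottom hn (by omega) (by omega),
    fun hn3 hn4 => ⟨?_, fun hne => ?_⟩⟩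
  · rintro ⟨j, -, hj⟩
    obtain ⟨e', x', z', h'⟩ := TauHankel.exists_isPeriodRun_beta' k j
    exact h'.H_side hn1 hn2 hj
  · have hne1 : m + n ≠ TauHankel.beta' k i + TauHankel.f (2 * k) + 1 := fun hc => hne ⟨i, hi0, Or.inl hc⟩
    have hne2 : m + n ≠ TauHankel.beta' k i + TauHankel.f (2 * k) + TauHankel.f (2 * k + 1) :=
      fun hc => hne ⟨i, hi0, Or.inr hc⟩
    exact h.H_eq_zero (by omega) (by omega) (by omega) hn3
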